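/- Let $\mathbb D$ be the open unit disc, $G=\mathrm{SU}(1,1)$ acting on $\mathbb D$ by $z\mapsto (az+b)/(cz+d)$ with $c=\bar b$, $d=\bar a$, and let $\tilde G$ be the universal covering group of $G$, acting on $\mathbb D$ through $G$. For $g\in\tilde G$ let $c_g$ be the lower left entry of the matrix below $g$, and for $s\in\mathbb R$ let $g'(z)^s$ be the continuous function on $\tilde G\times\mathbb D$, holomorphic in $z$, which is a branch of the power $s$ of the derivative $g'(z)=(cz+d)^{-2}$ and equals $1$ for $g=e$; precisely $g'(z)^s=\exp(-2s\log(cz+d))$ with $\log (cz+d)$ continued continuously from $0$ at $g=e$. Let $m\ge 0$, let $d_0,\dots,d_m$ be non-negative integers, $d=d_0+\dots+d_m$, $\mathbb C^d=\bigoplus_{j=0}^m\mathbb C^{d_j}$, let $\eta>0$, let $Y_j:\mathbb C^{d_{j-1}}\to\mathbb C^{d_j}$ ($1\le j\le m$) be arbitrary matrices, and let $N$ be an invertible block diagonal matrix with diagonal blocks $N_j$ of size $d_j\times d_j$ ($0\le j\le m$). For $\lambda>0$ let $\mathbb A^{(\lambda)}$ be the Hilbert space of holomorphic functions on $\mathbb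 D$ with reproducing kernel $(1-z\bar w)^{-2\lambda}$, and let $\mathbf A^{(\eta)}=\bigoplus_{j=0}^m\mathbb A^{(\eta+j)}\otimes\mathbb C^{d_j}$ be the Hilbert space direct sum, regarded as a space of functions $f=(f_0,\dots,f_m):\mathbb D\to\mathbb C^d$. With $(x)_k=x(x+1)\cdots(x+k-1)$, define $\Gamma_N^{(\eta,Y)}=\Gamma^{(\eta,Y)}\circ N$, where $$\big(\Gamma^{(\eta,Y)}f\big)_\ell=\sum_{j=0}^{\ell}\frac{1}{(\ell-j)!\,(2\eta+2j)_{\ell-j}}\,Y_\ell\cdots Y_{j+1}\,f_j^{(\ell-j)}\qquad(0\le \ell\le m),$$ and for $g\in\tilde G$, $z\in\mathbb D$ let $J_g^{(\eta,Y)}(z)$ be the block matrix with blocks $$\big(J^{(\eta,Y)}_g(z)\big)_{p,\ell}=\frac{(-c_g)^{p-\ell}}{(p-\ell)!}\,g'(z)^{\eta+\frac{p+\ell}{2}}\,Y_p\cdots Y_{\ell+1}\ \text{ if } p\ge\ell,\qquad 0\ \text{ if } p<\ell .$$ (The product $Y_\ell\cdots Y_{j+1}$ is the identity for $\ell=j$.)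 Then $\Gamma_N^{(\eta,Y)}$ is injective on $\mathbf A^{(\eta)}$, and its image $\mathcal H_N^{(\eta,Y)}$, with the norm for which $\Gamma_N^{(\eta,Y)}$ is an isometry from $\mathbf A^{(\eta)}$ onto $\mathcal H_N^{(\eta,Y)}$, is a Hilbert space of holomorphic functions $\mathbb D\to\mathbb C^d$ with the following properties. 1. $\tilde G$ acts unitarily on $\mathbf A^{(\eta)}$ by $(D_gf)_j(z)=(g^{-1})'(z)^{\eta+j}f_j(g^{-1}z)$ and unitarily on $\mathcal H_N^{(\eta,Y)}$ by the multiplier action $(U_gF)(z)=J^{(\eta,Y)}_{g^{-1}}(z)\,F(g^{-1}z)$, and $\Gamma_N^{(\eta,Y)}$ is equivariant: $\Gamma_N^{(\eta,Y)}D_g=U_g\Gamma_N^{(\eta,Y)}$ for all $g\in\tilde G$. 2. The point evaluations on $\mathcal H_N^{(\eta,Y)}$ are continuous, so it has a reproducing kernel $K_N^{(\eta,Y)}(z,w)$ (a $d\times d$ matrix, with $\langle F(z),\xi\rangle=\langle F,K_N^{(\eta,Y)}(\cdot,z)\xi\rangle$), and for $0\le\ell\le m$ $$\big(K_N^{(\eta,Y)}(0,0)\big)_{\ell\ell}=\sum_{j=0}^{\ell}\frac{1}{(\ell-j)!\,(2\eta+2j)_{\ell-j}}\;Y_\ell\cdots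 Y_{j+1}\,N_jN_j^*\,Y_{j+1}^*\cdots Y_\ell^* .$$ -/

import Mathlib

open Complex ComplexConjugate Topology
open scoped Complex.UnitDisc

noncomputable section

namespace MoebiusBundle

/-- The group `SU(1,1)` of matrices `((a, b), (conj b, conj a))` of determinant one. -/
def su11Subgroup : Subgroup (Matrix.SpecialLinearGroup (Fin 2) ℂ) where
  carrier := {g | g 1 0 = conj (g 0 1) ∧ g 1 1 = conj (g 0 0)}
  one_mem' := by simp
  mul_mem' := by
    rintro g h ⟨h1, h2⟩ ⟨h3, h4⟩
    simp [Matrix.mul_apply, h1, h2, h3, h4]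
    constructor <;> ring
  inv_mem' := by
    rintro g ⟨h1, h2⟩
    refine ⟨?_, ?_⟩ <;> simp [Matrix.SpecialLinearGroup.SL2_inv_expl, h1, h2]

/-- The group `SU(1,1)`, with the topology of the space of matrices. -/
abbrev SU11 : Type := su11Subgroup

namespace SU11

/-- The lower left entry of `g`. -/
def c (g : SU11) : ℂ := g.1 1 0

/-- The lower right entry of `g`. -/
def d (g : SU11) : ℂ := g.1 1 1

lemma apply_zero_zero (g : SU11) : g.1 0 0 = conj g.d := by simp [d, g.2.2]
lemma apply_zero_one (g : SU11) : g.1 0 1 = conj g.c := by simp [c, g.2.1]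

lemma ext_cd {g h : SU11} (hc : g.c = h.c) (hd : g.d = h.d) : g = h := by
  apply Subtype.ext
  apply Matrix.SpecialLinearGroup.ext
  intro i j
  fin_cases i <;> fin_cases j
  · exact (apply_zero_zero g).trans ((congrArg conj hd).trans (apply_zero_zero h).symm)
  · exact (apply_zero_one g).trans ((congrArg conj hc).trans (apply_zero_one h).symm)
  · exact hc
  · exact hd

lemma normSq_sub (g : SU11) : ‖g.d‖ ^ 2 - ‖g.c‖ ^ 2 = 1 := by
  have h := g.1.2
  rw [Matrix.det_fin_two] at h
  change g.1 0 0 * g.d - g.1 0 1 * g.c = 1 at h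
  rw [apply_zero_zero, apply_zero_one, ← Complex.normSq_eq_conj_mul_self,
    ← Complex.normSq_eq_conj_mul_self, Complex.normSq_eq_norm_sq, Complex.normSq_eq_norm_sq] at h
  exact_mod_cast h

lemma norm_c_lt (g : SU11) : ‖g.c‖ < ‖g.d‖ := by
  have := g.normSq_sub
  nlinarith [norm_nonneg g.c, norm_nonneg g.d]

lemma d_ne_zero (g : SU11) : g.d ≠ 0 := by
  have := g.norm_c_lt
  intro h
  rw [h, norm_zero] at this
  linarith [norm_nonneg g.c]

lemma norm_c_div_d (g : SU11) : ‖g.c / g.d‖ < 1 := by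
  rw [norm_div, div_lt_one (norm_pos_iff.2 g.d_ne_zero)]
  exact g.norm_c_lt

/-- The automorphy factor `c z + d`. -/
def den (g : SU11) (z : ℂ) : ℂ := g.c * z + g.d

lemma one_add_mem (g : SU11) (z : 𝔻) : 1 + g.c / g.d * (z : ℂ) ∈ slitPlane := by
  apply Complex.mem_slitPlane_of_norm_lt_one
  rw [norm_mul]
  have := g.norm_c_div_d
  nlinarith [norm_nonneg (g.c / g.d), norm_nonneg (z : ℂ), z.norm_lt_one]

lemma den_eq (g : SU11) (z : ℂ) : g.den z = g.d * (1 + g.c / g.d * z) := by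
  have := g.d_ne_zero
  rw [den]; field_simp; ring

lemma den_ne_zero (g : SU11) (z : 𝔻) : g.den z ≠ 0 := by
  rw [den_eq]
  exact mul_ne_zero g.d_ne_zero (slitPlane_ne_zero (g.one_add_mem z))

lemma norm_moebius_lt (g : SU11) (z : 𝔻) : ‖(g.1 0 0 * z + g.1 0 1) / g.den z‖ < 1 := by
  have h0 : 0 < ‖g.den z‖ := norm_pos_iff.2 (g.den_ne_zero z)
  rw [norm_div, div_lt_one h0, apply_zero_zero, apply_zero_one]
  apply lt_of_pow_lt_pow_left₀ 2 (norm_nonneg _)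
  have h1 := g.normSq_sub
  have h2 := z.sq_norm_lt_one
  simp only [den, Complex.sq_norm, Complex.normSq_apply, add_re, add_im, mul_re, mul_im, conj_re,
    conj_im] at *
  nlinarith

/-- `g` acts on the disc by `z ↦ (a z + b) / (c z + d)`. -/
instance : MulAction SU11 𝔻 where
  smul g z := .mk ((g.1 0 0 * z + g.1 0 1) / g.den z) (g.norm_moebius_lt z)
  one_smul z := by
    apply UnitDisc.coe_injective
    change ((1 : SU11).1 0 0 * (z : ℂ) + (1 : SU11).1 0 1) / (1 : SU11).den z = z
    simp [den, c, d]
  mul_smul g h z := by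
    apply UnitDisc.coe_injective
    change ((g * h).1 0 0 * (z : ℂ) + (g * h).1 0 1) / (g * h).den z =
      (g.1 0 0 * ((h.1 0 0 * z + h.1 0 1) / h.den z) + g.1 0 1) /
        g.den ((h.1 0 0 * z + h.1 0 1) / h.den z)
    have h1 := h.den_ne_zero z
    have e1 : (g * h).den z = g.den ((h.1 0 0 * z + h.1 0 1) / h.den z) * h.den z := by
      simp only [den] at h1 ⊢
      rw [add_mul, mul_assoc, div_mul_cancel₀ _ h1]
      simp [c, d, Matrix.mul_apply]
      ring
    have e2 : (g * h).1 0 0 * (z : ℂ) + (g * h).1 0 1 =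
        (g.1 0 0 * ((h.1 0 0 * z + h.1 0 1) / h.den z) + g.1 0 1) * h.den z := by
      rw [add_mul, mul_assoc, div_mul_cancel₀ _ h1]
      simp [den, c, d, Matrix.mul_apply]
      ring
    rw [e1, e2, mul_div_mul_right _ _ h1]

lemma coe_smul (g : SU11) (z : 𝔻) :
    ((g • z : 𝔻) : ℂ) = (g.1 0 0 * z + g.1 0 1) / g.den z := rfl

/-- The chain rule for the automorphy factor. -/
lemma den_mul (g h : SU11) (z : 𝔻) : (g * h).den z = g.den (h • z : 𝔻) * h.den z := by
  have h1 := h.den_ne_zero z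
  rw [coe_smul]
  simp only [den] at h1 ⊢
  rw [add_mul, mul_assoc, div_mul_cancel₀ _ h1]
  simp [c, d, Matrix.mul_apply]
  ring

/-- The derivative of the action is `(c z + d) ^ (-2)`. -/
lemma hasDerivAt (g : SU11) (z : 𝔻) :
    HasDerivAt (fun w : ℂ ↦ (g.1 0 0 * w + g.1 0 1) / g.den w) (g.den z ^ (-2 : ℤ)) (z : ℂ) := by
  have h1 := g.den_ne_zero z
  have hd : HasDerivAt g.den g.c (z : ℂ) := by
    have := ((hasDerivAt_id (z : ℂ)).const_mul g.c).add_const g.d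
    rw [mul_one] at this
    exact this
  have hn : HasDerivAt (fun w : ℂ ↦ g.1 0 0 * w + g.1 0 1) (g.1 0 0) (z : ℂ) := by
    simpa using ((hasDerivAt_id (z : ℂ)).const_mul (g.1 0 0)).add_const (g.1 0 1)
  convert! hn.div hd h1 using 1
  have h := g.1.2
  rw [Matrix.det_fin_two] at h
  change g.1 0 0 * g.d - g.1 0 1 * g.c = 1 at h
  rw [zpow_neg, eq_div_iff (pow_ne_zero 2 h1)]
  have e : (g.den z ^ (2 : ℤ))⁻¹ * g.den z ^ 2 = 1 := by
    rw [zpow_ofNat]; exact inv_mul_cancel₀ (pow_ne_zero 2 h1)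
  rw [e, den]
  linear_combination -h

@[fun_prop] lemma continuous_c : Continuous c := by unfold c; fun_prop
@[fun_prop] lemma continuous_d : Continuous d := by unfold d; fun_prop

/-- The matrix of `SU(1,1)` with prescribed lower row. -/
def ofRow (c d : ℂ) (h : ‖d‖ ^ 2 - ‖c‖ ^ 2 = 1) : SU11 :=
  ⟨⟨!![conj d, conj c; c, d], by
    rw [Matrix.det_fin_two_of, ← Complex.normSq_eq_conj_mul_self,
      ← Complex.normSq_eq_conj_mul_self, Complex.normSq_eq_norm_sq, Complex.normSq_eq_norm_sq]
    exact_mod_cast h⟩, by constructor <;> simp⟩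

@[simp] lemma c_ofRow (x y : ℂ) (h) : (ofRow x y h).c = x := by simp [ofRow, c]
@[simp] lemma d_ofRow (x y : ℂ) (h) : (ofRow x y h).d = y := by simp [ofRow, d]

lemma continuous_iff_cd {X : Type*} [TopologicalSpace X] {f : X → SU11} :
    Continuous f ↔ Continuous (fun x ↦ (f x).c) ∧ Continuous fun x ↦ (f x).d := by
  refine ⟨fun h ↦ ⟨by fun_prop, by fun_prop⟩, fun ⟨h1, h2⟩ ↦ ?_⟩
  refine continuous_induced_rng.2 (continuous_induced_rng.2 ?_)
  refine continuous_matrix fun i j ↦ ?_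
  fin_cases i <;> fin_cases j
  · exact (continuous_conj.comp h2).congr fun x ↦ (apply_zero_zero (f x)).symm
  · exact (continuous_conj.comp h1).congr fun x ↦ (apply_zero_one (f x)).symm
  · exact h1
  · exact h2

instance : ContinuousSMul SU11 𝔻 where
  continuous_smul := by
    refine UnitDisc.isEmbedding_coe.continuous_iff.2 ?_
    change Continuous fun p : SU11 × 𝔻 ↦ (p.1.1 0 0 * (p.2 : ℂ) + p.1.1 0 1) / p.1.den p.2
    refine Continuous.div ?_ ?_ fun p ↦ p.1.den_ne_zero p.2
    · simp only [apply_zero_zero, apply_zero_one]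
      have h1 : Continuous fun p : SU11 × 𝔻 ↦ conj p.1.c := continuous_conj.comp (by fun_prop)
      have h2 : Continuous fun p : SU11 × 𝔻 ↦ conj p.1.d := continuous_conj.comp (by fun_prop)
      exact (h2.mul (by fun_prop)).add h1
    · simp only [den]; fun_prop

end SU11


instance : LocallyCompactSpace 𝔻 :=
  (Metric.isOpen_ball (x := (0 : ℂ)) (ε := 1)).locallyCompactSpace

/-- The universal covering group of `SU(1,1)`: pairs of a matrix `g` and a continuous logarithm
`φ` on the disc of its automorphy factor `c z + d`. It is a subspace of `SU(1,1) × C(𝔻, ℂ)` with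
the compact-open topology; see below for the proofs that it is a simply connected topological group
and that the projection to `SU(1,1)` is a covering homomorphism. -/
def UCover : Type := {x : SU11 × C(𝔻, ℂ) // ∀ z : 𝔻, exp (x.2 z) = x.1.den z}

namespace UCover

/-- The matrix in `SU(1,1)` below `g`. -/
def mat (g : UCover) : SU11 := g.1.1

/-- The chosen logarithm of the automorphy factor. -/
def logDen (g : UCover) : C(𝔻, ℂ) := g.1.2

lemma exp_logDen (g : UCover) (z : 𝔻) : exp (g.logDen z) = g.mat.den z := g.2 z

lemma ext_iff' {g h : UCover} : g = h ↔ g.mat = h.mat ∧ ∀ z, g.logDen z = h.logDen z := by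
  rw [← ContinuousMap.ext_iff]
  exact Subtype.ext_iff.trans Prod.ext_iff

instance : TopologicalSpace UCover := instTopologicalSpaceSubtype

/-- The action of a matrix as a continuous map of the disc. -/
def actMap (g : SU11) : C(𝔻, 𝔻) := ⟨fun z ↦ g • z, by fun_prop⟩

lemma continuous_actMap : Continuous actMap :=
  ContinuousMap.continuous_of_continuous_uncurry _ continuous_smul

/-- The product is `(g, φ) (h, ψ) = (g h, φ ∘ h + ψ)`. -/
instance : Mul UCover where
  mul g h := ⟨(g.mat * h.mat, g.logDen.comp (actMap h.mat) + h.logDen), fun z ↦ by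
    rw [SU11.den_mul, ← g.exp_logDen, ← h.exp_logDen, ← Complex.exp_add]; rfl⟩

instance : One UCover where
  one := ⟨(1, 0), fun z ↦ by simp [SU11.den, SU11.c, SU11.d]⟩

instance : Inv UCover where
  inv g := ⟨(g.mat⁻¹, -g.logDen.comp (actMap g.mat⁻¹)), fun z ↦ by
    have h := SU11.den_mul g.mat g.mat⁻¹ z
    rw [mul_inv_cancel] at h
    have h1 : (1 : SU11).den z = 1 := by simp [SU11.den, SU11.c, SU11.d]
    rw [h1, ← g.exp_logDen] at h
    simp only [ContinuousMap.neg_apply, ContinuousMap.comp_apply, Complex.exp_neg]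
    exact inv_eq_of_mul_eq_one_right h.symm⟩

lemma mat_mul (g h : UCover) : (g * h).mat = g.mat * h.mat := rfl
lemma mat_one : (1 : UCover).mat = 1 := rfl
lemma mat_inv (g : UCover) : (g⁻¹).mat = g.mat⁻¹ := rfl
lemma logDen_mul (g h : UCover) (z : 𝔻) :
    (g * h).logDen z = g.logDen (h.mat • z) + h.logDen z := rfl
lemma logDen_one (z : 𝔻) : (1 : UCover).logDen z = 0 := rfl
lemma logDen_inv (g : UCover) (z : 𝔻) : (g⁻¹).logDen z = -g.logDen (g.mat⁻¹ • z) := rfl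

instance : Group UCover := Group.ofLeftAxioms
  (fun g h k ↦ ext_iff'.2 ⟨by simp only [mat_mul, mul_assoc], fun z ↦ by
    simp only [logDen_mul, mat_mul, mul_smul, add_assoc]⟩)
  (fun g ↦ ext_iff'.2 ⟨by simp only [mat_mul, mat_one, one_mul], fun z ↦ by
    simp only [logDen_mul, logDen_one, zero_add]⟩)
  (fun g ↦ ext_iff'.2 ⟨by simp only [mat_mul, mat_inv, mat_one, inv_mul_cancel], fun z ↦ by
    simp only [logDen_mul, logDen_inv, logDen_one, inv_smul_smul, neg_add_cancel]⟩)

/-- The covering homomorphism to `SU(1,1)`. -/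
def proj : UCover →* SU11 where
  toFun := mat
  map_one' := rfl
  map_mul' _ _ := rfl

/-- The action on the disc through the projection. -/
instance : MulAction UCover 𝔻 := MulAction.compHom 𝔻 proj

/-- The power `g'(z) ^ s = (c z + d) ^ (-2 s)`, by the branch of the logarithm that `g` carries. -/
def derivPow (g : UCover) (z : 𝔻) (s : ℝ) : ℂ := exp (-2 * s * g.logDen z)

lemma smul_def (g : UCover) (z : 𝔻) : g • z = g.mat • z := rfl

/-- The exponent `1` gives the derivative of the action. -/
lemma derivPow_one (g : UCover) (z : 𝔻) : g.derivPow z 1 = g.mat.den z ^ (-2 : ℤ) := by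
  rw [derivPow, ← g.exp_logDen, ← Complex.exp_int_mul]
  simp

@[fun_prop] lemma continuous_mat : Continuous mat := continuous_fst.comp continuous_subtype_val
@[fun_prop] lemma continuous_logDen : Continuous logDen :=
  continuous_snd.comp continuous_subtype_val

lemma continuous_iff {X : Type*} [TopologicalSpace X] {f : X → UCover} :
    Continuous f ↔ Continuous (fun x ↦ (f x).mat) ∧ Continuous fun x ↦ (f x).logDen := by
  refine ⟨fun h ↦ ⟨by fun_prop, by fun_prop⟩, fun ⟨h1, h2⟩ ↦ ?_⟩
  exact continuous_induced_rng.2 (h1.prodMk h2)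

/-- The powers of the derivative are jointly continuous. -/
lemma continuous_derivPow (s : ℝ) : Continuous fun p : UCover × 𝔻 ↦ p.1.derivPow p.2 s := by
  unfold derivPow
  have : Continuous fun p : UCover × 𝔻 ↦ p.1.logDen p.2 :=
    (continuous_logDen.comp continuous_fst).eval continuous_snd
  fun_prop

instance : IsTopologicalGroup UCover where
  continuous_mul := continuous_iff.2 ⟨by
      change Continuous fun p : UCover × UCover ↦ p.1.mat * p.2.mat
      fun_prop, by
      change Continuous fun p : UCover × UCover ↦ p.1.logDen.comp (actMap p.2.mat) + p.2.logDen
      have h1 := continuous_actMap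
      have h2 : Continuous fun p : UCover × UCover ↦ p.1.logDen.comp (actMap p.2.mat) :=
        (continuous_logDen.comp continuous_fst).compCM
          (h1.comp (continuous_mat.comp continuous_snd))
      fun_prop⟩
  continuous_inv := continuous_iff.2 ⟨by
      change Continuous fun g : UCover ↦ g.mat⁻¹
      fun_prop, by
      change Continuous fun g : UCover ↦ -g.logDen.comp (actMap g.mat⁻¹)
      have h1 := continuous_actMap
      have h2 : Continuous fun g : UCover ↦ g.logDen.comp (actMap g.mat⁻¹) :=
        continuous_logDen.compCM (h1.comp (continuous_inv.comp continuous_mat))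
      fun_prop⟩

/-- An element is determined by its matrix and the value of its logarithm at the centre. -/
lemma ext_zero {g h : UCover} (h1 : g.mat = h.mat) (h2 : g.logDen 0 = h.logDen 0) : g = h := by
  refine ext_iff'.2 ⟨h1, fun z ↦ ?_⟩
  have : PreconnectedSpace 𝔻 := Subtype.preconnectedSpace (convex_ball (0 : ℂ) 1).isPreconnected
  refine congrFun (isCoveringMap_exp.eq_of_comp_eq g.logDen.continuous h.logDen.continuous ?_
    0 h2) z
  funext w
  apply Subtype.ext
  change exp (g.logDen w) = exp (h.logDen w)
  rw [exp_logDen, exp_logDen, h1]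

/-- The square root of `1 + |c|²`. -/
def rad (c : ℂ) : ℝ := √(1 + ‖c‖ ^ 2)

lemma rad_pos (c : ℂ) : 0 < rad c := Real.sqrt_pos.2 (by positivity)

lemma rad_sq (c : ℂ) : rad c ^ 2 = 1 + ‖c‖ ^ 2 := Real.sq_sqrt (by positivity)

lemma norm_d (g : SU11) : ‖g.d‖ = rad g.c := by
  rw [rad, eq_comm, Real.sqrt_eq_iff_eq_sq (by positivity) (norm_nonneg _)]
  linarith [g.normSq_sub]

lemma ofCirc_aux (c : ℂ) (u : Circle) : ‖(rad c : ℂ) * u‖ ^ 2 - ‖c‖ ^ 2 = 1 := by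
  rw [norm_mul, Circle.norm_coe, mul_one, Complex.norm_real, Real.norm_eq_abs, sq_abs, rad_sq]
  ring

lemma continuous_rad : Continuous rad := by unfold rad; fun_prop

lemma norm_d_div (g : SU11) : ‖g.d / (rad g.c : ℂ)‖ = 1 := by
  rw [norm_div, Complex.norm_real, Real.norm_eq_abs, abs_of_pos (rad_pos _), norm_d,
    div_self (rad_pos _).ne']

/-- `SU(1,1)` is homeomorphic to `ℂ × Circle`. -/
def matHomeo : ℂ × Circle ≃ₜ SU11 where
  toFun p := SU11.ofRow p.1 (rad p.1 * p.2) (ofCirc_aux _ _)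
  invFun g := (g.c, ⟨g.d / rad g.c, mem_sphere_zero_iff_norm.2 (norm_d_div g)⟩)
  left_inv p := by
    refine Prod.ext (SU11.c_ofRow _ _ (ofCirc_aux _ _)) (Circle.ext ?_)
    change (SU11.ofRow p.1 (rad p.1 * p.2) (ofCirc_aux _ _)).d /
      (rad (SU11.ofRow p.1 (rad p.1 * p.2) (ofCirc_aux _ _)).c : ℂ) = _
    rw [SU11.c_ofRow, SU11.d_ofRow]
    exact mul_div_cancel_left₀ _ (by exact_mod_cast (rad_pos _).ne')
  right_inv g := by
    refine SU11.ext_cd (SU11.c_ofRow _ _ (ofCirc_aux _ _))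
        ((SU11.d_ofRow _ _ (ofCirc_aux _ _)).trans ?_)
    exact mul_div_cancel₀ _ (by exact_mod_cast (rad_pos _).ne')
  continuous_toFun := by
    have h := continuous_rad
    refine SU11.continuous_iff_cd.2 ⟨?_, ?_⟩
    · simpa only [SU11.c_ofRow] using continuous_fst
    · simp only [SU11.d_ofRow]
      have h2 : Continuous fun p : ℂ × Circle ↦ rad p.1 := h.comp continuous_fst
      fun_prop
  continuous_invFun := by
    refine SU11.continuous_c.prodMk (continuous_induced_rng.2 ?_)
    change Continuous fun g : SU11 ↦ g.d / (rad g.c : ℂ)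
    have h2 : Continuous fun g : SU11 ↦ (rad g.c : ℂ) :=
      continuous_ofReal.comp (continuous_rad.comp SU11.continuous_c)
    exact SU11.continuous_d.div h2 fun g ↦ by exact_mod_cast (rad_pos _).ne'

lemma continuous_logOne :
    Continuous fun p : SU11 × 𝔻 ↦ log (1 + p.1.c / p.1.d * (p.2 : ℂ)) := by
  refine Continuous.clog ?_ fun p ↦ p.1.one_add_mem p.2
  have : Continuous fun p : SU11 × 𝔻 ↦ p.1.c / p.1.d :=
    (SU11.continuous_c.comp continuous_fst).div (SU11.continuous_d.comp continuous_fst)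
      fun p ↦ p.1.d_ne_zero
  fun_prop

/-- The logarithm of `1 + (c / d) z`. -/
def logOne (g : SU11) : C(𝔻, ℂ) :=
  ⟨fun z ↦ log (1 + g.c / g.d * (z : ℂ)),
    Continuous.clog (by fun_prop) fun z ↦ g.one_add_mem z⟩

/-- `UCover` is homeomorphic to `ℂ × ℝ`. -/
def homeo : ℂ × ℝ ≃ₜ UCover where
  toFun p := ⟨(matHomeo (p.1, Circle.exp p.2),
      ContinuousMap.const 𝔻 ((Real.log (rad p.1) : ℂ) + p.2 * I) +
        logOne (matHomeo (p.1, Circle.exp p.2))), fun z ↦ by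
    change exp (((Real.log (rad p.1) : ℂ) + p.2 * I) + log _) = _
    rw [Complex.exp_add, Complex.exp_log (slitPlane_ne_zero (SU11.one_add_mem _ _)), SU11.den_eq,
      Complex.exp_add, ← Complex.ofReal_exp, Real.exp_log (rad_pos _)]
    congr 1⟩
  invFun g := (g.mat.c, (g.logDen 0).im)
  left_inv p := by
    refine Prod.ext (SU11.c_ofRow _ _ (ofCirc_aux _ _)) ?_
    change (((Real.log (rad p.1) : ℂ) + p.2 * I) + log (1 + _ * ((0 : 𝔻) : ℂ))).im = p.2
    simp
  right_inv g := by
    have h0 : exp (g.logDen 0) = g.mat.d := by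
      rw [exp_logDen, SU11.den]; simp
    have hre : (g.logDen 0).re = Real.log (rad g.mat.c) := by
      rw [← norm_d, ← h0, Complex.norm_exp, Real.log_exp]
    refine ext_zero ?_ ?_
    · refine SU11.ext_cd (SU11.c_ofRow _ _ (ofCirc_aux _ _))
        ((SU11.d_ofRow _ _ (ofCirc_aux _ _)).trans ?_)
      change (rad g.mat.c : ℂ) * (Circle.exp (g.logDen 0).im : ℂ) = _
      rw [← h0, Circle.coe_exp, ← Real.exp_log (rad_pos g.mat.c), ← hre, Complex.ofReal_exp,
        ← Complex.exp_add, Complex.re_add_im]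
    · change ((Real.log (rad g.mat.c) : ℂ) + (g.logDen 0).im * I) +
        log (1 + _ * ((0 : 𝔻) : ℂ)) = _
      rw [← hre, Complex.re_add_im]
      simp
  continuous_toFun := by
    have h1 : Continuous fun p : ℂ × ℝ ↦ matHomeo (p.1, Circle.exp p.2) :=
      matHomeo.continuous.comp (by fun_prop)
    refine continuous_iff.2 ⟨h1, ?_⟩
    change Continuous fun p : ℂ × ℝ ↦ ContinuousMap.const 𝔻 ((Real.log (rad p.1) : ℂ) + p.2 * I) +
        logOne (matHomeo (p.1, Circle.exp p.2))
    have h2 : Continuous logOne := ContinuousMap.continuous_of_continuous_uncurry _ continuous_logOne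
    have h3 : Continuous fun p : ℂ × ℝ ↦ Real.log (rad p.1) :=
      (continuous_rad.comp continuous_fst).log fun p ↦ (rad_pos _).ne'
    have h4 : Continuous fun p : ℂ × ℝ ↦ (Real.log (rad p.1) : ℂ) + p.2 * I := by fun_prop
    exact (ContinuousMap.continuous_const'.comp h4).add (h2.comp h1)
  continuous_invFun := by
    have h1 : Continuous fun g : UCover ↦ g.logDen 0 :=
      continuous_logDen.eval_const (0 : 𝔻)
    exact (SU11.continuous_c.comp continuous_mat).prodMk (Complex.continuous_im.comp h1)

instance : SimplyConnectedSpace UCover := by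
  have : ContractibleSpace UCover := homeo.symm.contractibleSpace
  infer_instance

lemma isOpenQuotientMap_proj : IsOpenQuotientMap proj := by
  have h : IsOpenQuotientMap (matHomeo ∘ Prod.map id Circle.exp ∘ homeo.symm) :=
    matHomeo.isOpenQuotientMap.comp ((IsOpenQuotientMap.prodMap .id
      Circle.isAddQuotientCoveringMap_exp.isOpenQuotientMap).comp homeo.symm.isOpenQuotientMap)
  convert h using 1
  funext g
  obtain ⟨p, rfl⟩ := homeo.surjective g
  simp only [Function.comp_apply, Homeomorph.symm_apply_apply]
  rfl

/-- The projection to `SU(1,1)` is a covering map. -/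
theorem isCoveringMap_proj : IsCoveringMap proj := by
  refine (isOpenQuotientMap_proj.isQuotientMap.isQuotientCoveringMap_of_isDiscrete_ker_monoidHom
    ?_).isCoveringMap
  have hd : DiscreteTopology (AddSubgroup.zmultiples (2 * Real.pi * I)) :=
    NormedSpace.discreteTopology_zmultiples _
  have hmat : ∀ g : proj.ker, g.1.mat = 1 := fun g ↦ g.2
  let f : proj.ker → AddSubgroup.zmultiples (2 * Real.pi * I) := fun g ↦ ⟨g.1.logDen 0, by
    have h := g.1.exp_logDen 0
    rw [hmat g] at h
    have h1 : exp (g.1.logDen 0) = 1 := by rw [h]; simp [SU11.den, SU11.c, SU11.d]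
    obtain ⟨n, hn⟩ := Complex.exp_eq_one_iff.1 h1
    exact ⟨n, by simpa using hn.symm⟩⟩
  have hf : Continuous f :=
    ((continuous_logDen.comp continuous_subtype_val).eval_const (0 : 𝔻)).subtype_mk _
  have hinj : Function.Injective f := fun g h e ↦ Subtype.ext <|
    ext_zero ((hmat g).trans (hmat h).symm) (congrArg Subtype.val e)
  exact ⟨DiscreteTopology.of_continuous_injective hf hinj⟩

end UCover


/-- The kernel `(1 - z * conj w) ^ (-2 * lam)` times the identity of `V`. -/
def bergmanKernel (lam : Set.Ioi (0 : ℝ)) (V : Type*) [NormedAddCommGroup V]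
    [InnerProductSpace ℂ V] : Matrix 𝔻 𝔻 (V →L[ℂ] V) :=
  .of fun z w ↦ ((1 - (z : ℂ) * conj (w : ℂ)) ^ (-(2 * (lam : ℝ) : ℂ))) • ContinuousLinearMap.id ℂ V

lemma hasSum_kernel (a : ℝ) (x : ℂ) (hx : ‖x‖ < 1) :
    HasSum (fun n : ℕ ↦ ((Ring.multichoose a n : ℝ) : ℂ) * x ^ n) ((1 - x) ^ (-(a : ℂ))) := by
  have h := (one_div_one_sub_cpow_hasFPowerSeriesOnBall_zero (a : ℂ)).hasSum (y := x)
    (by simpa [Metric.mem_eball, edist_zero_right, enorm_eq_nnnorm, ← NNReal.coe_lt_coe] using hx)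
  rw [zero_add, one_div, ← Complex.cpow_neg] at h
  refine h.congr_fun fun n ↦ ?_
  rw [FormalMultilinearSeries.ofScalars_apply_eq, smul_eq_mul, ← Ring.multichoose_eq]
  congr 1
  exact Ring.map_multichoose Complex.ofRealHom a n

lemma multichoose_nonneg {a : ℝ} (ha : 0 < a) (n : ℕ) : 0 ≤ Ring.multichoose a n := by
  have h := Ring.factorial_nsmul_multichoose_eq_ascPochhammer a n
  rw [Polynomial.ascPochhammer_smeval_eq_eval, nsmul_eq_mul] at h
  have h1 := ascPochhammer_pos n a ha
  rw [← h] at h1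
  exact (pos_of_mul_pos_right h1 (Nat.cast_nonneg _)).le

lemma norm_mul_conj_lt (z w : 𝔻) : ‖(z : ℂ) * conj (w : ℂ)‖ < 1 := by
  rw [norm_mul, Complex.norm_conj]
  nlinarith [norm_nonneg (z : ℂ), norm_nonneg (w : ℂ), z.norm_lt_one, w.norm_lt_one]

lemma conj_kernel (a : ℝ) (z w : 𝔻) :
    conj ((1 - (z : ℂ) * conj (w : ℂ)) ^ (-(a : ℂ))) =
      (1 - (w : ℂ) * conj (z : ℂ)) ^ (-(a : ℂ)) := by
  have h : 1 - (z : ℂ) * conj (w : ℂ) ∈ slitPlane := by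
    have := Complex.mem_slitPlane_of_norm_lt_one (z := -((z : ℂ) * conj (w : ℂ)))
      (by rw [norm_neg]; exact norm_mul_conj_lt z w)
    rwa [← sub_eq_add_neg] at this
  have h2 := Complex.conj_cpow _ (-(a : ℂ)) (Complex.slitPlane_arg_ne_pi h)
  simp only [map_neg, conj_ofReal, map_sub, map_one, map_mul, Complex.conj_conj] at h2
  rw [← h2, mul_comm]

lemma posSemidef_bergmanKernel (lam : Set.Ioi (0 : ℝ)) (V : Type*) [NormedAddCommGroup V]
    [InnerProductSpace ℂ V] [CompleteSpace V] : (bergmanKernel lam V).PosSemidef := by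
  obtain ⟨lam, hlam⟩ := lam
  have ha : 0 < 2 * lam := mul_pos two_pos hlam
  have hK : ∀ z w : 𝔻, bergmanKernel ⟨lam, hlam⟩ V z w =
      ((1 - (z : ℂ) * conj (w : ℂ)) ^ (-((2 * lam : ℝ) : ℂ))) • ContinuousLinearMap.id ℂ V := by
    intro z w
    simp [bergmanKernel]
  have h0 := (RKHS.posSemidef_tfae (K := bergmanKernel ⟨lam, hlam⟩ V)).out 0 2
  refine h0.2 ⟨?_, fun v ↦ ?_⟩
  · ext1 z w
    rw [Matrix.conjTranspose_apply, hK, hK, star_smul, ← conj_kernel (2 * lam) w z]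
    congr 1
    exact star_one _
  · have h : HasSum (fun n : ℕ ↦ Ring.multichoose (2 * lam) n *
        ‖∑ x ∈ v.support, (conj (x : ℂ)) ^ n • v x‖ ^ 2)
        (RCLike.re (v.sum fun x w ↦ v.sum fun x' w' ↦
          inner ℂ (bergmanKernel ⟨lam, hlam⟩ V x' x w) w')) := by
      have h1 : HasSum (fun n : ℕ ↦ ∑ x ∈ v.support, ∑ x' ∈ v.support,
          ((Ring.multichoose (2 * lam) n : ℝ) : ℂ) * ((x : ℂ) * conj (x' : ℂ)) ^ n *
            inner ℂ (v x) (v x'))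
          (v.sum fun x w ↦ v.sum fun x' w' ↦
            inner ℂ (bergmanKernel ⟨lam, hlam⟩ V x' x w) w') := by
        refine hasSum_sum fun x _ ↦ hasSum_sum fun x' _ ↦ ?_
        beta_reduce
        rw [hK]
        simp only [FunLike.coe_smul, Pi.smul_apply, ContinuousLinearMap.id_apply,
          inner_smul_left, conj_kernel]
        exact (hasSum_kernel (2 * lam) _ (norm_mul_conj_lt x x')).mul_right _
      refine ((Complex.hasSum_re h1)).congr_fun fun n ↦ ?_
      rw [← inner_self_eq_norm_sq (𝕜 := ℂ), ← RCLike.re_ofReal_mul]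
      simp only [sum_inner, inner_sum, inner_smul_left, inner_smul_right, Finset.mul_sum]
      change Complex.re _ = Complex.re _
      congr 1
      rw [Finset.sum_comm]
      refine Finset.sum_congr rfl fun x _ ↦ Finset.sum_congr rfl fun x' _ ↦ ?_
      simp [mul_pow]
      ring
    exact h.nonneg fun n ↦ mul_nonneg (multichoose_nonneg ha n) (by positivity)

/-- The Hilbert space `𝔸^(lam) ⊗ V` of holomorphic functions `𝔻 → V` with reproducing kernel
`(1 - z * conj w) ^ (-2 * lam)` times the identity. -/
def Bergman (lam : Set.Ioi (0 : ℝ)) (V : Type*) [NormedAddCommGroup V] [InnerProductSpace ℂ V]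
    [CompleteSpace V] : Type _ :=
  haveI : Fact (bergmanKernel lam V).PosSemidef := ⟨posSemidef_bergmanKernel lam V⟩
  RKHS.OfKernel (bergmanKernel lam V)

namespace Bergman

variable (lam : Set.Ioi (0 : ℝ)) (V : Type*) [NormedAddCommGroup V] [InnerProductSpace ℂ V]
  [CompleteSpace V]

instance : Fact (bergmanKernel lam V).PosSemidef := ⟨posSemidef_bergmanKernel lam V⟩

instance : NormedAddCommGroup (Bergman lam V) :=
  inferInstanceAs (NormedAddCommGroup (RKHS.OfKernel (bergmanKernel lam V)))

instance : InnerProductSpace ℂ (Bergman lam V) :=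
  inferInstanceAs (InnerProductSpace ℂ (RKHS.OfKernel (bergmanKernel lam V)))

instance : CompleteSpace (Bergman lam V) :=
  inferInstanceAs (CompleteSpace (RKHS.OfKernel (bergmanKernel lam V)))

instance : RKHS ℂ (Bergman lam V) 𝔻 V :=
  inferInstanceAs (RKHS ℂ (RKHS.OfKernel (bergmanKernel lam V)) 𝔻 V)

lemma kernel_eq : RKHS.kernel (Bergman lam V) = bergmanKernel lam V :=
  RKHS.OfKernel.kernel_ofKernel (K := bergmanKernel lam V)

end Bergman

section Calculus

variable {W : Type*} [NormedAddCommGroup W] [NormedSpace ℂ W]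

/-- Holomorphy of a function on the disc. -/
def IsHol (f : 𝔻 → W) : Prop :=
  DifferentiableOn ℂ (Function.extend ((↑) : 𝔻 → ℂ) f 0) (Metric.ball 0 1)

/-- The `k`-th complex derivative of a function on the disc. -/
def discDeriv (k : ℕ) (f : 𝔻 → W) (z : 𝔻) : W :=
  iteratedDeriv k (Function.extend ((↑) : 𝔻 → ℂ) f 0) z

end Calculus

section Blocks

variable {m : ℕ}

/-- `ℂ^d`, as the orthogonal direct sum of the spaces `ℂ^(d j)` for `j = 0, …, m`. -/
abbrev Fib (d : Fin (m + 1) → ℕ) : Type := PiLp 2 fun j ↦ EuclideanSpace ℂ (Fin (d j))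

variable {d : Fin (m + 1) → ℕ}

/-- The block `(l, j)` of the identity matrix. -/
def oneBlock (l j : Fin (m + 1)) : Matrix (Fin (d l)) (Fin (d j)) ℂ :=
  .of fun a b ↦ if (⟨l, a⟩ : Σ i, Fin (d i)) = ⟨j, b⟩ then 1 else 0

/-- The product `Y_l ⋯ Y_(j+1)` for `j ≤ l` (the identity if `l = j`), and zero for `l < j`. Here
`Y i : ℂ^(d i) → ℂ^(d (i + 1))` is the block that is written `Y_(i+1)` in this product. -/
def yProd (Y : ∀ i : Fin m, Matrix (Fin (d i.succ)) (Fin (d i.castSucc)) ℂ) (j : Fin (m + 1)) :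
    ∀ l : Fin (m + 1), Matrix (Fin (d l)) (Fin (d j)) ℂ :=
  Fin.induction (oneBlock 0 j) fun i P ↦ if j ≤ i.castSucc then Y i * P else oneBlock i.succ j

lemma oneBlock_self (j : Fin (m + 1)) : oneBlock (d := d) j j = 1 := by
  ext a b
  simp [oneBlock, Matrix.one_apply]

lemma oneBlock_of_ne {l j : Fin (m + 1)} (h : l ≠ j) : oneBlock (d := d) l j = 0 := by
  ext a b
  simp [oneBlock, h]

variable (Y : ∀ i : Fin m, Matrix (Fin (d i.succ)) (Fin (d i.castSucc)) ℂ)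

lemma yProd_succ {j : Fin (m + 1)} {i : Fin m} (h : j ≤ i.castSucc) :
    yProd Y j i.succ = Y i * yProd Y j i.castSucc := by
  simp [yProd, h]

lemma yProd_self (j : Fin (m + 1)) : yProd Y j j = 1 := by
  induction j using Fin.cases with
  | zero => simp [yProd, oneBlock_self]
  | succ i => simp [yProd, oneBlock_self, Fin.succ_le_castSucc_iff]

lemma yProd_of_lt {j l : Fin (m + 1)} (h : l < j) : yProd Y j l = 0 := by
  induction l using Fin.cases with
  | zero => simp [yProd, oneBlock_of_ne h.ne]
  | succ i =>
    have : ¬ j ≤ i.castSucc := not_le.2 (i.castSucc_lt_succ.trans h)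
    simp [yProd, this, oneBlock_of_ne h.ne]

/-- The action of a block matrix on `ℂ^d`. -/
def blockMulVec (B : ∀ p l, Matrix (Fin (d p)) (Fin (d l)) ℂ) (v : Fib d) : Fib d :=
  WithLp.toLp 2 fun p ↦ WithLp.toLp 2 (∑ l, (B p l).mulVec (v l).ofLp)

/-- The diagonal block `(l, l)` of the matrix of an operator on `ℂ^d`. -/
def diagBlock (T : Fib d →L[ℂ] Fib d) (l : Fin (m + 1)) : Matrix (Fin (d l)) (Fin (d l)) ℂ :=
  .of fun a b ↦ T (PiLp.single 2 l (EuclideanSpace.single b 1)) l a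

/-- The multiplier `J_g(z)` with parameters `η` and `Y`. Its block `(p, l)` is
`(-c_g)^(p-l) / (p-l)! * g'(z)^(η + (p+l)/2) * Y_p ⋯ Y_(l+1)` for `p ≥ l`, and zero for `p < l`. -/
def multiplier (η : ℝ) (g : UCover) (z : 𝔻) (p l : Fin (m + 1)) :
    Matrix (Fin (d p)) (Fin (d l)) ℂ :=
  if l ≤ p then
    ((1 / ((p : ℕ) - (l : ℕ)).factorial : ℂ) * (-g.mat.c) ^ ((p : ℕ) - (l : ℕ)) *
      g.derivPow z (η + ((p : ℕ) + (l : ℕ)) / 2)) • yProd Y l p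
  else 0

/-- The coefficient `1 / ((l-j)! * (2η+2j)_(l-j))`, where `(x)_k = x (x+1) ⋯ (x+k-1)`. -/
def gammaCoeff (η : ℝ) (j l : ℕ) : ℝ :=
  1 / (((l - j).factorial : ℝ) * (ascPochhammer ℝ (l - j)).eval (2 * η + 2 * j))

/-- The differential operator `Γ`: the component of index `l` of `Γ F` is
`∑_(j ≤ l) 1 / ((l-j)! * (2η+2j)_(l-j)) * Y_l ⋯ Y_(j+1) * F_j^(l-j)`. -/
def gammaOp (η : ℝ) (F : 𝔻 → Fib d) (z : 𝔻) : Fib d :=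
  WithLp.toLp 2 fun l ↦ WithLp.toLp 2 (∑ j, if j ≤ l then
    (gammaCoeff η j l : ℂ) • (yProd Y j l).mulVec
      (discDeriv ((l : ℕ) - (j : ℕ)) (fun w ↦ F w j) z).ofLp
  else 0)

/-- The pointwise action of the block diagonal matrix with diagonal blocks `N j`. -/
def diagOp (N : ∀ j, Matrix (Fin (d j)) (Fin (d j)) ℂ) (F : 𝔻 → Fib d) (z : 𝔻) : Fib d :=
  WithLp.toLp 2 fun j ↦ WithLp.toLp 2 ((N j).mulVec (F z j).ofLp)

/-- The operator `Γ_N`, the composition of `Γ` and `N`. -/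
def gammaN (η : ℝ) (N : ∀ j, Matrix (Fin (d j)) (Fin (d j)) ℂ) (F : 𝔻 → Fib d) : 𝔻 → Fib d :=
  gammaOp Y η (diagOp N F)

end Blocks

section Sum

variable {m : ℕ}

/-- The Hilbert space direct sum of the spaces `𝔸^(η+j) ⊗ ℂ^(d j)` for `j = 0, …, m`. -/
abbrev BergmanSum (d : Fin (m + 1) → ℕ) (η : ℝ) (hη : 0 < η) : Type :=
  PiLp 2 fun j : Fin (m + 1) ↦
    Bergman ⟨η + (j : ℕ), add_pos_of_pos_of_nonneg hη (Nat.cast_nonneg _)⟩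
      (EuclideanSpace ℂ (Fin (d j)))

variable {d : Fin (m + 1) → ℕ} {η : ℝ} {hη : 0 < η}

/-- The function `𝔻 → ℂ^d` with components `f j`. -/
def BergmanSum.toFunction (f : BergmanSum d η hη) (z : 𝔻) : Fib d :=
  WithLp.toLp 2 fun j ↦ f j z

end Sum

end MoebiusBundle

end

open MoebiusBundle
open scoped Complex.UnitDisc

/-!
The operator `Γ_N` intertwines two actions because of one formula for higher derivatives: if `f` is
holomorphic on the disc and `s > 0`, then
`(g'^s • f ∘ g)^(k) = ∑_(i ≤ k) (k choose i) (2s+i)_(k-i) (-c_g)^(k-i) g'^(s+(k+i)/2) • f^(i) ∘ g`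
(`IsHol.discDeriv_derivPow_smul`), by induction on `k` from `(g'^s)' = -2 s c_g g'^(s+1/2)`. After
division by `k! (2s)_k` the coefficients become the scalar factors of the multiplier, for
`s = η + j` (`IsHol.gammaCoeff_smul_discDeriv`); the matrix factors agree since
`Y_p ⋯ Y_(l+1)` times `Y_l ⋯ Y_(j+1)` is `Y_p ⋯ Y_(j+1)` (`gammaN_bergmanSumAction`).

The action on a weighted Bergman space is unitary because its reproducing kernel is invariant. The
invariance needs an identity of logarithms, not only of automorphy factors: it holds because
two continuous logarithms of the same function on the connected space `𝔻 × 𝔻` that agree at the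
centre are equal (`UCover.log_one_sub_smul`). That a weighted composition operator which
preserves the kernel is unitary is a general fact about reproducing kernel Hilbert spaces
(`exists_linearIsometryEquiv_of_kernel_invariant`).

The elements of a weighted Bergman space are holomorphic, and the evaluations of their derivatives
are continuous by the Cauchy estimates, so the point evaluations of `Γ_N f` are continuous in `f`.
The operator `Γ_N` is injective as a triangular operator with invertible diagonal blocks. Hence the
Hilbert space on which it is defined, embedded in the functions on the disc by `Γ_N` itself, is a
reproducing kernel Hilbert space, the image of `Γ_N` (`GammaSpace`), and the action there is the one
transported by `Γ_N`. Its kernel at the centre is `E E*` for the evaluation `E` at the centre. The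
`k`-th derivative at the centre of `𝔸^(lam)`, composed with its adjoint, is the scalar
`k! (2 lam)_k` (`Bergman.derivCLM_zero_adjoint`), which cancels one of the two coefficients of
`Γ` in each diagonal block of `E E*`.
-/

noncomputable section

namespace MoebiusBundle

/-! ### Differential calculus of functions on the disc -/

section DiscCalculus

/-- The extension by zero of a function on the disc to the complex plane. -/
abbrev discExtend {W : Type*} [Zero W] (f : 𝔻 → W) : ℂ → W := Function.extend ((↑) : 𝔻 → ℂ) f 0

lemma discExtend_coe {W : Type*} [Zero W] (f : 𝔻 → W) (z : 𝔻) : discExtend f z = f z :=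
  UnitDisc.coe_injective.extend_apply f 0 z

lemma eqOn_ball_of_forall_coe {W : Type*} {F G : ℂ → W} (h : ∀ z : 𝔻, F z = G z) :
    Set.EqOn F G (Metric.ball 0 1) :=
  fun z hz ↦ h (.mk z (mem_ball_zero_iff.1 hz))

lemma coe_mem_ball (z : 𝔻) : (z : ℂ) ∈ Metric.ball (0 : ℂ) 1 :=
  mem_ball_zero_iff.2 z.norm_lt_one

lemma ball_mem_nhds_coe (z : 𝔻) : Metric.ball (0 : ℂ) 1 ∈ 𝓝 (z : ℂ) :=
  Metric.isOpen_ball.mem_nhds (coe_mem_ball z)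

lemma eventuallyEq_discExtend {W : Type*} [Zero W] {f : 𝔻 → W} {G : ℂ → W}
    (h : ∀ z : 𝔻, G z = f z) (z : 𝔻) :
    discExtend f =ᶠ[𝓝 (z : ℂ)] G :=
  (eqOn_ball_of_forall_coe fun w ↦ (discExtend_coe f w).trans (h w).symm).eventuallyEq_of_mem
    (ball_mem_nhds_coe z)

variable {W W' : Type*} [NormedAddCommGroup W] [NormedSpace ℂ W] [NormedAddCommGroup W']
  [NormedSpace ℂ W']

lemma isHol_of_differentiableOn {f : 𝔻 → W} {G : ℂ → W} (h : ∀ z : 𝔻, G z = f z)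
    (hG : DifferentiableOn ℂ G (Metric.ball 0 1)) : IsHol f :=
  hG.congr <| eqOn_ball_of_forall_coe fun w ↦ (discExtend_coe f w).trans (h w).symm

lemma isHol_of_hasDerivAt {f g : 𝔻 → W}
    (h : ∀ z : 𝔻, HasDerivAt (discExtend f) (g z) z) : IsHol f := fun z hz ↦
  (h (.mk z (mem_ball_zero_iff.1 hz))).differentiableAt.differentiableWithinAt

lemma discDeriv_zero (f : 𝔻 → W) : discDeriv 0 f = f := by
  funext z
  rw [discDeriv, iteratedDeriv_zero]
  exact discExtend_coe f z

lemma eventuallyEq_discExtend_discDeriv (f : 𝔻 → W) (k : ℕ) (z : 𝔻) :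
    discExtend (discDeriv k f) =ᶠ[𝓝 (z : ℂ)] iteratedDeriv k (discExtend f) :=
  eventuallyEq_discExtend (fun _ ↦ rfl) z

lemma discDeriv_succ {f g : 𝔻 → W} {k : ℕ}
    (h : ∀ z : 𝔻, HasDerivAt (discExtend (discDeriv k f)) (g z) z) : discDeriv (k + 1) f = g := by
  funext z
  rw [discDeriv, iteratedDeriv_succ]
  exact ((h z).congr_of_eventuallyEq (eventuallyEq_discExtend_discDeriv f k z).symm).deriv

lemma IsHol.hasDerivAt_discDeriv [CompleteSpace W] {f : 𝔻 → W} (hf : IsHol f) (k : ℕ) (z : 𝔻) :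
    HasDerivAt (discExtend (discDeriv k f)) (discDeriv (k + 1) f z) z := by
  have h : AnalyticAt ℂ (discExtend f) z := hf.analyticAt (ball_mem_nhds_coe z)
  have h1 : DifferentiableAt ℂ (iteratedDeriv k (discExtend f)) z := by
    rw [iteratedDeriv_eq_iterate]
    exact (h.iterated_deriv k).differentiableAt
  have h2 := h1.hasDerivAt.congr_of_eventuallyEq (eventuallyEq_discExtend_discDeriv f k z)
  rwa [← iteratedDeriv_succ] at h2

lemma IsHol.discDeriv [CompleteSpace W] {f : 𝔻 → W} (hf : IsHol f) (k : ℕ) :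
    IsHol (discDeriv k f) :=
  isHol_of_hasDerivAt (hf.hasDerivAt_discDeriv k)

lemma discExtend_clm_comp (A : W →L[ℂ] W') (f : 𝔻 → W) (z : 𝔻) :
    discExtend (fun w ↦ A (f w)) =ᶠ[𝓝 (z : ℂ)] fun w ↦ A (discExtend f w) :=
  eventuallyEq_discExtend (fun w ↦ by rw [discExtend_coe]) z

lemma IsHol.clm_comp {f : 𝔻 → W} (hf : IsHol f) (A : W →L[ℂ] W') : IsHol fun z ↦ A (f z) :=
  isHol_of_differentiableOn (G := fun w ↦ A (discExtend f w)) (fun w ↦ by rw [discExtend_coe])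
    (A.differentiable.comp_differentiableOn hf)

lemma IsHol.discDeriv_clm_comp [CompleteSpace W] {f : 𝔻 → W} (hf : IsHol f) (A : W →L[ℂ] W')
    (k : ℕ) : MoebiusBundle.discDeriv k (fun z ↦ A (f z)) =
      fun z ↦ A (MoebiusBundle.discDeriv k f z) := by
  induction k with
  | zero => simp only [discDeriv_zero]
  | succ k ih =>
    refine discDeriv_succ fun z ↦ ?_
    rw [ih]
    exact (A.hasFDerivAt.comp_hasDerivAt _ (hf.hasDerivAt_discDeriv k z)).congr_of_eventuallyEq
      (discExtend_clm_comp A _ z)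

lemma IsHol.sum {ι : Type*} {s : Finset ι} {f : ι → 𝔻 → W} (hf : ∀ i ∈ s, IsHol (f i)) :
    IsHol fun z ↦ ∑ i ∈ s, f i z :=
  isHol_of_differentiableOn (G := fun w ↦ ∑ i ∈ s, discExtend (f i) w)
    (fun w ↦ by simp only [discExtend_coe]) (DifferentiableOn.fun_sum hf)

lemma hasDerivAt_discExtend {f : 𝔻 → W} {G : ℂ → W} (h : ∀ z : 𝔻, G z = f z) {z : 𝔻} {f' : W}
    (hG : HasDerivAt G f' z) : HasDerivAt (discExtend f) f' z :=
  hG.congr_of_eventuallyEq (eventuallyEq_discExtend h z)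

lemma IsHol.add {f g : 𝔻 → W} (hf : IsHol f) (hg : IsHol g) : IsHol (f + g) :=
  isHol_of_differentiableOn (G := discExtend f + discExtend g)
    (fun w ↦ by simp only [Pi.add_apply, discExtend_coe]) (DifferentiableOn.add hf hg)

lemma IsHol.discDeriv_add [CompleteSpace W] {f g : 𝔻 → W} (hf : IsHol f) (hg : IsHol g) (k : ℕ) :
    MoebiusBundle.discDeriv k (f + g) =
      MoebiusBundle.discDeriv k f + MoebiusBundle.discDeriv k g := by
  induction k with
  | zero => simp only [discDeriv_zero]
  | succ k ih =>
    refine discDeriv_succ fun z ↦ ?_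
    rw [ih]
    exact hasDerivAt_discExtend (fun w ↦ by simp only [Pi.add_apply, discExtend_coe])
      ((hf.hasDerivAt_discDeriv k z).add (hg.hasDerivAt_discDeriv k z))

lemma IsHol.discDeriv_const_smul [CompleteSpace W] {f : 𝔻 → W} (hf : IsHol f) (c : ℂ) (k : ℕ) :
    MoebiusBundle.discDeriv k (c • f) = c • MoebiusBundle.discDeriv k f :=
  hf.discDeriv_clm_comp (c • ContinuousLinearMap.id ℂ W) k

lemma discDeriv_pow_smul [CompleteSpace W] (k : ℕ) (v : W) (z : 𝔻) :
    discDeriv k (fun w : 𝔻 ↦ (w : ℂ) ^ k • v) z = (k.factorial : ℂ) • v := by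
  have h : IsHol fun w : 𝔻 ↦ (w : ℂ) ^ k :=
    isHol_of_differentiableOn (G := fun w ↦ w ^ k) (fun _ ↦ rfl) (by fun_prop)
  have h1 := congrFun (h.discDeriv_clm_comp (ContinuousLinearMap.toSpanSingleton ℂ v) k) z
  simp only [ContinuousLinearMap.toSpanSingleton_apply] at h1
  rw [h1, discDeriv,
    (eventuallyEq_discExtend (G := fun w ↦ w ^ k) (fun _ ↦ rfl) z).iteratedDeriv_eq,
    iteratedDeriv_pow]
  simp [Nat.descFactorial_self]

end DiscCalculus

/-! ### Unitary weighted composition operators on reproducing kernel Hilbert spaces -/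

section WeightedComposition

variable {X V H : Type*} [NormedAddCommGroup V] [InnerProductSpace ℂ V] [CompleteSpace V]
  [NormedAddCommGroup H] [InnerProductSpace ℂ H] [CompleteSpace H] [RKHS ℂ H X V]

/-- If a nowhere vanishing weight `j` and a surjection `φ` of the base leave the reproducing kernel
invariant, then `f ↦ j • f ∘ φ` is unitary: its adjoint is the isometry that maps the kernel
function at `x` with vector `v` to the kernel function at `φ x` with vector `conj (j x) • v`. -/
lemma exists_linearIsometryEquiv_of_kernel_invariant {φ : X → X} {j : X → ℂ}
    (hφ : Function.Surjective φ) (hj : ∀ x, j x ≠ 0)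
    (hK : ∀ x y, (j x * conj (j y)) • RKHS.kernel H (φ x) (φ y) = RKHS.kernel H x y) :
    ∃ T : H ≃ₗᵢ[ℂ] H, ∀ f x, T f x = j x • f (φ x) := by
  -- `e₁` parametrizes the span of the kernel functions, `e₂` the span of their prescribed images.
  let e₁ : (X × V →₀ ℂ) →ₗ[ℂ] H := Finsupp.linearCombination ℂ fun p ↦ RKHS.kerFun H p.1 p.2
  let e₂ : (X × V →₀ ℂ) →ₗ[ℂ] H :=
    Finsupp.linearCombination ℂ fun p ↦ RKHS.kerFun H (φ p.1) (conj (j p.1) • p.2)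
  have hd : ∀ e : X × V → H, Set.range e = {RKHS.kerFun H x v | (x) (v)} →
      DenseRange (Finsupp.linearCombination ℂ e) := by
    intro e he
    have h := RKHS.kerFun_dense H
    rw [← he, ← Finsupp.range_linearCombination,
      ← Submodule.dense_iff_topologicalClosure_eq_top] at h
    exact h
  have h₁ : DenseRange e₁ := hd _ (by ext; simp)
  have h₂ : DenseRange e₂ := by
    refine hd _ (Set.ext fun f ↦ ⟨?_, ?_⟩)
    · rintro ⟨p, rfl⟩
      exact ⟨_, _, rfl⟩
    · rintro ⟨x, v, rfl⟩
      obtain ⟨y, rfl⟩ := hφ x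
      refine ⟨(y, (conj (j y))⁻¹ • v), ?_⟩
      simp [smul_smul, hj y]
  -- By the invariance of the kernel, the Gram matrices of both families agree.
  have hn : ∀ s, ‖e₂ s‖ = ‖e₁ s‖ := by
    intro s
    rw [← sq_eq_sq₀ (norm_nonneg _) (norm_nonneg _), ← inner_self_eq_norm_sq (𝕜 := ℂ),
      ← inner_self_eq_norm_sq (𝕜 := ℂ)]
    simp only [e₁, e₂, Finsupp.linearCombination_apply, Finsupp.sum_inner, Finsupp.inner_sum,
      inner_smul_left, inner_smul_right, ← RKHS.kernel_inner]
    refine congrArg _ (Finset.sum_congr rfl fun p _ ↦ ?_)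
    refine congrArg _ (Finset.sum_congr rfl fun q _ ↦ ?_)
    beta_reduce
    rw [← hK p.1 q.1]
    simp only [map_smul, inner_smul_left, FunLike.coe_smul, Pi.smul_apply,
      map_mul, Complex.conj_conj]
    ring
  let A := (LinearEquiv.refl ℂ (X × V →₀ ℂ)).extendOfIsometry e₁ e₂ h₁ h₂ hn
  have hA : ∀ x v, A (RKHS.kerFun H x v) = RKHS.kerFun H (φ x) (conj (j x) • v) := by
    intro x v
    have := LinearEquiv.extendOfIsometry_eq (LinearEquiv.refl ℂ (X × V →₀ ℂ)) e₁ e₂ h₁ h₂ hn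
      (.single (x, v) 1)
    simpa only [e₁, e₂, LinearEquiv.refl_apply, Finsupp.linearCombination_single,
      one_smul] using this
  refine ⟨A.symm, fun f x ↦ ext_inner_left ℂ fun v ↦ ?_⟩
  rw [← RKHS.kerFun_inner, ← A.inner_map_map, hA, A.apply_symm_apply, RKHS.kerFun_inner,
    inner_smul_left, inner_smul_right, Complex.conj_conj]

end WeightedComposition

/-! ### The automorphy factor and its logarithm -/

instance : PreconnectedSpace 𝔻 :=
  Subtype.preconnectedSpace (convex_ball (0 : ℂ) 1).isPreconnected

/-- Uniqueness of continuous logarithms on a connected space. -/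
lemma eq_of_exp_eq {X : Type*} [TopologicalSpace X] [PreconnectedSpace X] {f g : X → ℂ}
    (hf : Continuous f) (hg : Continuous g) (h : ∀ x, exp (f x) = exp (g x)) (x₀ : X)
    (h₀ : f x₀ = g x₀) (x : X) : f x = g x := by
  refine congrFun (isCoveringMap_exp.eq_of_comp_eq hf hg ?_ x₀ h₀) x
  funext y
  exact Subtype.ext (h y)

lemma one_sub_mul_conj_mem_slitPlane (z w : 𝔻) : 1 - (z : ℂ) * conj (w : ℂ) ∈ slitPlane := by
  have := Complex.mem_slitPlane_of_norm_lt_one (z := -((z : ℂ) * conj (w : ℂ)))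
    (by rw [norm_neg]; exact norm_mul_conj_lt z w)
  rwa [← sub_eq_add_neg] at this

lemma SU11.one_sub_smul_mul_conj_smul (g : SU11) (z w : 𝔻) :
    (1 - ((g • z : 𝔻) : ℂ) * conj ((g • w : 𝔻) : ℂ)) * (g.den z * conj (g.den w)) =
      1 - (z : ℂ) * conj (w : ℂ) := by
  have hz := g.den_ne_zero z
  have hw : conj (g.den w) ≠ 0 := (map_ne_zero _).2 (g.den_ne_zero w)
  have hdet : g.d * conj g.d - g.c * conj g.c = 1 := by
    rw [Complex.mul_conj, Complex.mul_conj, Complex.normSq_eq_norm_sq, Complex.normSq_eq_norm_sq]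
    exact_mod_cast g.normSq_sub
  rw [coe_smul, coe_smul, map_div₀, div_mul_div_comm, sub_mul,
    div_mul_cancel₀ _ (mul_ne_zero hz hw), apply_zero_zero, apply_zero_one]
  simp only [den, map_add, map_mul, Complex.conj_conj]
  linear_combination (1 - (z : ℂ) * conj (w : ℂ)) * hdet

namespace UCover

/-- The logarithm of the transformation rule of `1 - z * conj w`. Both sides are continuous
logarithms of `1 - z * conj w` on the connected space `𝔻 × 𝔻`, and they agree at the centre, where
both are real. -/
lemma log_one_sub_smul (g : UCover) (z w : 𝔻) :
    log (1 - ((g • z : 𝔻) : ℂ) * conj ((g • w : 𝔻) : ℂ)) + (g.logDen z + conj (g.logDen w)) =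
      log (1 - (z : ℂ) * conj (w : ℂ)) := by
  have hexp : ∀ p : 𝔻 × 𝔻,
      exp (log (1 - ((g • p.1 : 𝔻) : ℂ) * conj ((g • p.2 : 𝔻) : ℂ)) +
        (g.logDen p.1 + conj (g.logDen p.2))) = exp (log (1 - (p.1 : ℂ) * conj (p.2 : ℂ))) := by
    intro p
    rw [Complex.exp_log (slitPlane_ne_zero (one_sub_mul_conj_mem_slitPlane _ _)), Complex.exp_add,
      Complex.exp_add, Complex.exp_log (slitPlane_ne_zero (one_sub_mul_conj_mem_slitPlane _ _)),
      Complex.exp_conj, exp_logDen, exp_logDen, smul_def, smul_def]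
    exact g.mat.one_sub_smul_mul_conj_smul p.1 p.2
  have hsm : Continuous fun z : 𝔻 ↦ ((g • z : 𝔻) : ℂ) :=
    UnitDisc.continuous_coe.comp (continuous_const_smul g.mat)
  -- On the diagonal, the argument of the logarithm is a positive real number.
  have hreal : ∀ z : 𝔻, (log (1 - (z : ℂ) * conj (z : ℂ))).im = 0 := by
    intro z
    rw [Complex.mul_conj, ← Complex.ofReal_one, ← Complex.ofReal_sub, ← Complex.ofReal_log]
    · exact Complex.ofReal_im _
    · rw [Complex.normSq_eq_norm_sq]
      nlinarith [z.sq_norm_lt_one]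
  refine eq_of_exp_eq (X := 𝔻 × 𝔻)
    (f := fun p ↦ log (1 - ((g • p.1 : 𝔻) : ℂ) * conj ((g • p.2 : 𝔻) : ℂ)) +
        (g.logDen p.1 + conj (g.logDen p.2)))
    (g := fun p ↦ log (1 - (p.1 : ℂ) * conj (p.2 : ℂ))) ?_ ?_ hexp (0, 0) ?_ (z, w)
  · refine (Continuous.clog ?_ fun p ↦ one_sub_mul_conj_mem_slitPlane _ _).add ?_
    · exact continuous_const.sub ((hsm.comp continuous_fst).mul
        (continuous_conj.comp (hsm.comp continuous_snd)))
    · exact (g.logDen.continuous.comp continuous_fst).add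
        (continuous_conj.comp (g.logDen.continuous.comp continuous_snd))
  · refine Continuous.clog ?_ fun p ↦ one_sub_mul_conj_mem_slitPlane _ _
    exact continuous_const.sub ((UnitDisc.continuous_coe.comp continuous_fst).mul
        (continuous_conj.comp (UnitDisc.continuous_coe.comp continuous_snd)))
  -- The real parts agree because the exponentials do, and the imaginary parts vanish.
  · have h := congrArg norm (hexp (0, 0))
    rw [Complex.norm_exp, Complex.norm_exp, Real.exp_eq_exp] at h
    refine Complex.ext h ?_
    simp only [Complex.add_im, hreal, Complex.conj_im]
    ring

lemma derivPow_ne_zero (g : UCover) (z : 𝔻) (s : ℝ) : g.derivPow z s ≠ 0 := Complex.exp_ne_zero _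

lemma derivPow_mul (g h : UCover) (z : 𝔻) (s : ℝ) :
    (g * h).derivPow z s = g.derivPow (h • z) s * h.derivPow z s := by
  rw [derivPow, derivPow, derivPow, ← Complex.exp_add, logDen_mul, smul_def, mul_add]

lemma derivPow_add (g : UCover) (z : 𝔻) (s t : ℝ) :
    g.derivPow z (s + t) = g.derivPow z s * g.derivPow z t := by
  rw [derivPow, derivPow, derivPow, ← Complex.exp_add]
  push_cast
  congr 1
  ring

/-- The logarithm carried by `g`, through the principal logarithm. -/
lemma logDen_eq (g : UCover) (z : 𝔻) :
    g.logDen z = g.logDen 0 + log (1 + g.mat.c / g.mat.d * z) := by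
  refine eq_of_exp_eq (f := g.logDen) (g := fun z ↦ g.logDen 0 + logOne g.mat z)
    g.logDen.continuous (by fun_prop) (fun w ↦ ?_) 0 ?_ z
  · have h : g.mat.den (0 : 𝔻) = g.mat.d := by simp [SU11.den]
    change _ = exp (g.logDen 0 + log (1 + g.mat.c / g.mat.d * w))
    rw [Complex.exp_add, Complex.exp_log (slitPlane_ne_zero (g.mat.one_add_mem w)), exp_logDen,
      exp_logDen, h, SU11.den_eq]
  · simp [logOne]

lemma derivPow_half (g : UCover) (z : 𝔻) : g.derivPow z (1 / 2) = (g.mat.den z)⁻¹ := by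
  rw [derivPow, ← exp_logDen, ← Complex.exp_neg]
  push_cast
  congr 1
  ring

/-- The derivative of `g'(z) ^ s`. -/
lemma hasDerivAt_derivPow (g : UCover) (s : ℝ) (z : 𝔻) :
    HasDerivAt (discExtend fun w ↦ g.derivPow w s)
      (-2 * s * g.mat.c * g.derivPow z (s + 1 / 2)) z := by
  have hd := g.mat.d_ne_zero
  have h1 : HasDerivAt (fun w : ℂ ↦ 1 + g.mat.c / g.mat.d * w) (g.mat.c / g.mat.d) z := by
    simpa using ((hasDerivAt_id (z : ℂ)).const_mul (g.mat.c / g.mat.d)).const_add 1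
  have h2 := (((h1.clog (g.mat.one_add_mem z)).const_add (g.logDen 0)).const_mul
    (-2 * (s : ℂ))).cexp
  refine (hasDerivAt_discExtend (fun w ↦ ?_) h2).congr_deriv ?_
  · rw [derivPow, logDen_eq g w]
  · rw [← logDen_eq g z, derivPow_add, derivPow_half, SU11.den_eq]
    have h3 := slitPlane_ne_zero (g.mat.one_add_mem z)
    rw [derivPow]
    field_simp

lemma hasDerivAt_comp_smul {W : Type*} [NormedAddCommGroup W] [NormedSpace ℂ W] (g : UCover)
    {f : 𝔻 → W} {f' : W} {z : 𝔻} (hf : HasDerivAt (discExtend f) f' (g • z : 𝔻)) :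
    HasDerivAt (discExtend fun w ↦ f (g • w)) (g.derivPow z 1 • f') z := by
  rw [derivPow_one]
  have h := hf.scomp (z : ℂ) (g.mat.hasDerivAt z)
  exact hasDerivAt_discExtend (fun w ↦ discExtend_coe f (g • w)) h

end UCover

/-! ### The unitary action on the weighted Bergman spaces -/

lemma bergmanKernel_apply (lam : Set.Ioi (0 : ℝ)) (V : Type*) [NormedAddCommGroup V]
    [InnerProductSpace ℂ V] (z w : 𝔻) :
    bergmanKernel lam V z w = ((1 - (z : ℂ) * conj (w : ℂ)) ^ (-((2 * (lam : ℝ) : ℝ) : ℂ))) •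
      ContinuousLinearMap.id ℂ V := by
  simp [bergmanKernel]

/-- The Bergman kernel is invariant under the action with weight `g'(z) ^ lam`. -/
lemma bergmanKernel_smul_smul (lam : Set.Ioi (0 : ℝ)) (V : Type*) [NormedAddCommGroup V]
    [InnerProductSpace ℂ V] (g : UCover) (z w : 𝔻) :
    (g.derivPow z lam * conj (g.derivPow w lam)) • bergmanKernel lam V (g • z) (g • w) =
      bergmanKernel lam V z w := by
  rw [bergmanKernel_apply, bergmanKernel_apply, smul_smul]
  congr 1
  rw [Complex.cpow_def_of_ne_zero (slitPlane_ne_zero (one_sub_mul_conj_mem_slitPlane _ _)),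
    Complex.cpow_def_of_ne_zero (slitPlane_ne_zero (one_sub_mul_conj_mem_slitPlane _ _)),
    ← g.log_one_sub_smul z w, UCover.derivPow, UCover.derivPow, ← Complex.exp_conj,
    ← Complex.exp_add, ← Complex.exp_add]
  congr 1
  simp only [map_mul, map_neg, Complex.conj_ofReal, map_ofNat]
  push_cast
  ring

namespace Bergman

variable (lam : Set.Ioi (0 : ℝ)) (V : Type*) [NormedAddCommGroup V] [InnerProductSpace ℂ V]
  [CompleteSpace V]

lemma exists_isometry (g : UCover) : ∃ T : Bergman lam V ≃ₗᵢ[ℂ] Bergman lam V,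
    ∀ f z, T f z = g.derivPow z lam • f (g • z) :=
  exists_linearIsometryEquiv_of_kernel_invariant (MulAction.surjective g)
    (fun z ↦ g.derivPow_ne_zero z lam) fun z w ↦ by
      rw [kernel_eq]
      exact bergmanKernel_smul_smul lam V g z w

/-- The unitary action of the covering group on `𝔸^(lam) ⊗ V`. -/
def action : UCover →* (Bergman lam V ≃ₗᵢ[ℂ] Bergman lam V) :=
  MonoidHom.mk' (fun g ↦ (exists_isometry lam V g⁻¹).choose) fun g h ↦ by
    ext f z
    rw [LinearIsometryEquiv.coe_mul, Function.comp_apply]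
    simp only [(exists_isometry lam V _).choose_spec]
    rw [mul_inv_rev, UCover.derivPow_mul, mul_smul h⁻¹ g⁻¹ z, mul_comm, mul_smul]

lemma action_apply (g : UCover) (f : Bergman lam V) (z : 𝔻) :
    action lam V g f z = g⁻¹.derivPow z lam • f (g⁻¹ • z) :=
  (exists_isometry lam V g⁻¹).choose_spec f z

end Bergman

/-! ### Holomorphy and derivatives in the weighted Bergman spaces -/

namespace Bergman

variable {lam : Set.Ioi (0 : ℝ)} {V : Type*} [NormedAddCommGroup V] [InnerProductSpace ℂ V]
  [CompleteSpace V]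

lemma norm_kerFun_le {r : ℝ} (hr : r < 1) (z : 𝔻) (hz : ‖(z : ℂ)‖ ≤ r) :
    ‖RKHS.kerFun (Bergman lam V) z‖ ≤ √((1 - r ^ 2) ^ (-(2 * (lam : ℝ)))) := by
  rw [RKHS.norm_kerFun_eq_sqrt_norm_kernel, kernel_eq, bergmanKernel_apply, norm_smul]
  refine Real.sqrt_le_sqrt ((mul_le_of_le_one_right (norm_nonneg _)
    ContinuousLinearMap.norm_id_le).trans ?_)
  have h0 := norm_nonneg (z : ℂ)
  have h1 : 0 < 1 - ‖(z : ℂ)‖ ^ 2 := by nlinarith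
  rw [Complex.mul_conj, Complex.normSq_eq_norm_sq, ← Complex.ofReal_one, ← Complex.ofReal_sub,
    ← Complex.ofReal_neg, ← Complex.ofReal_cpow h1.le, Complex.norm_real,
    Real.norm_of_nonneg (Real.rpow_nonneg h1.le _)]
  refine Real.rpow_le_rpow_of_nonpos ?_ ?_ ?_
  · nlinarith
  · nlinarith
  · have := lam.2.out
    linarith

lemma kerFun_eq (w : 𝔻) (v : V) (z : 𝔻) : RKHS.kerFun (Bergman lam V) w v z =
    ((1 - (z : ℂ) * conj (w : ℂ)) ^ (-((2 * (lam : ℝ) : ℝ) : ℂ))) • v := by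
  rw [RKHS.kerFun_apply, kernel_eq, bergmanKernel_apply]
  simp

lemma hasDerivAt_one_sub_cpow (a : ℂ) (w z : 𝔻) :
    HasDerivAt (fun z : ℂ ↦ (1 - z * conj (w : ℂ)) ^ (-a))
      (a * conj (w : ℂ) * (1 - (z : ℂ) * conj (w : ℂ)) ^ (-(a + 1))) z := by
  have h1 : HasDerivAt (fun z : ℂ ↦ 1 - z * conj (w : ℂ)) (-conj (w : ℂ)) z := by
    simpa using ((hasDerivAt_id (z : ℂ)).mul_const (conj (w : ℂ))).const_sub 1
  refine (h1.cpow_const (c := -a) (one_sub_mul_conj_mem_slitPlane z w)).congr_deriv ?_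
  rw [neg_add']
  ring

lemma discDeriv_kerFun (k : ℕ) (w : 𝔻) (v : V) :
    discDeriv k (RKHS.kerFun (Bergman lam V) w v) = fun z : 𝔻 ↦
      ((((ascPochhammer ℝ k).eval (2 * (lam : ℝ)) : ℝ) : ℂ) * conj (w : ℂ) ^ k *
        (1 - (z : ℂ) * conj (w : ℂ)) ^ (-(((2 * (lam : ℝ) : ℝ) : ℂ) + k))) • v := by
  induction k with
  | zero =>
    funext z
    simp [discDeriv_zero, kerFun_eq]
  | succ k ih =>
    refine discDeriv_succ fun z ↦ ?_
    rw [ih]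
    refine hasDerivAt_discExtend (fun w ↦ rfl) ((((hasDerivAt_one_sub_cpow _ w z).const_mul
      ((((ascPochhammer ℝ k).eval (2 * (lam : ℝ)) : ℝ) : ℂ) *
        conj (w : ℂ) ^ k)).smul_const v).congr_deriv ?_)
    congr 1
    rw [ascPochhammer_succ_eval]
    push_cast
    ring_nf

lemma isHol_kerFun (w : 𝔻) (v : V) : IsHol (RKHS.kerFun (Bergman lam V) w v) := by
  refine isHol_of_differentiableOn (G := fun z : ℂ ↦
    ((1 - z * conj (w : ℂ)) ^ (-((2 * (lam : ℝ) : ℝ) : ℂ))) • v)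
    (fun z ↦ (kerFun_eq w v z).symm) fun z hz ↦ ?_
  exact ((hasDerivAt_one_sub_cpow _ w (.mk z (mem_ball_zero_iff.1 hz))).smul_const
    v).differentiableAt.differentiableWithinAt

/-- The elements of the weighted Bergman space are holomorphic: they are limits of linear
combinations of kernel functions, locally uniformly because the kernel is locally bounded. -/
lemma isHol (f : Bergman lam V) : IsHol f := by
  have hspan : ∀ f ∈ Submodule.span ℂ {RKHS.kerFun (Bergman lam V) x v | (x) (v)},
      IsHol (f : 𝔻 → V) := by
    intro f hf
    induction hf using Submodule.span_induction with
    | mem f hf =>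
      obtain ⟨w, v, rfl⟩ := hf
      exact isHol_kerFun w v
    | zero => exact isHol_of_differentiableOn (G := 0) (by simp) (differentiableOn_const 0)
    | add f g _ _ hf hg =>
      rw [RKHS.coe_add]
      exact hf.add hg
    | smul c f _ hf =>
      rw [RKHS.coe_smul]
      exact hf.clm_comp (c • ContinuousLinearMap.id ℂ V)
  have hmem : f ∈ (Submodule.span ℂ
      {RKHS.kerFun (Bergman lam V) x v | (x) (v)}).topologicalClosure := by
    rw [RKHS.kerFun_dense]
    trivial
  obtain ⟨F, hF, hlim⟩ := mem_closure_iff_seq_limit.1 hmem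
  refine TendstoLocallyUniformlyOn.differentiableOn (φ := Filter.atTop)
    (F := fun n ↦ discExtend (F n)) ?_ (.of_forall fun n ↦ hspan _ (hF n)) Metric.isOpen_ball
  intro u hu x hx
  obtain ⟨r, hxr, hr⟩ := exists_between (mem_ball_zero_iff.1 hx)
  refine ⟨Metric.ball 0 r, mem_nhdsWithin_of_mem_nhds
    (Metric.isOpen_ball.mem_nhds (mem_ball_zero_iff.2 hxr)), ?_⟩
  have h := RKHS.tendstoUniformlyOn_of_norm_kerFun_le (s := {z : 𝔻 | ‖(z : ℂ)‖ ≤ r})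
    (fun z hz ↦ norm_kerFun_le hr z hz) hlim
  filter_upwards [h u hu] with n hn y hy
  have hy := mem_ball_zero_iff.1 hy
  have := hn (.mk y (hy.trans hr)) hy.le
  rwa [← discExtend_coe f, ← discExtend_coe (F n)] at this

lemma norm_discDeriv_le (k : ℕ) (z : 𝔻) :
    ∃ C : ℝ, ∀ f : Bergman lam V, ‖discDeriv k f z‖ ≤ C * ‖f‖ := by
  have hz := z.norm_lt_one
  obtain ⟨r, hzr, hr⟩ := exists_between hz
  have hR : 0 < r - ‖(z : ℂ)‖ := sub_pos.2 hzr
  have hsub : ∀ w ∈ Metric.closedBall (z : ℂ) (r - ‖(z : ℂ)‖), ‖w‖ ≤ r := by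
    intro w hw
    have h1 := mem_closedBall_iff_norm.1 hw
    have h2 := norm_add_le (w - z) z
    rw [sub_add_cancel] at h2
    linarith
  refine ⟨k.factorial * √((1 - r ^ 2) ^ (-(2 * (lam : ℝ)))) / (r - ‖(z : ℂ)‖) ^ k, fun f ↦ ?_⟩
  have hd : DiffContOnCl ℂ (discExtend f) (Metric.ball (z : ℂ) (r - ‖(z : ℂ)‖)) :=
    (isHol f).diffContOnCl_ball
      fun w hw ↦ mem_ball_zero_iff.2 ((hsub w hw).trans_lt hr)
  refine (Complex.norm_iteratedDeriv_le_of_forall_mem_sphere_norm_le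
    (C := ‖f‖ * √((1 - r ^ 2) ^ (-(2 * (lam : ℝ))))) k hR hd fun w hw ↦ ?_).trans_eq (by ring)
  have hw := hsub w (Metric.sphere_subset_closedBall hw)
  change ‖discExtend f (UnitDisc.mk w (hw.trans_lt hr) : 𝔻)‖ ≤ _
  rw [discExtend_coe]
  refine (RKHS.norm_apply_le f _).trans (mul_le_mul_of_nonneg_left ?_ (norm_nonneg f))
  rw [← RKHS.norm_kerFun_eq_sqrt_norm_kernel]
  exact norm_kerFun_le hr _ hw

variable (lam V) in
/-- The evaluation of the `k`-th derivative at a point, which is continuous on the weighted Bergman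
space by the Cauchy estimates. -/
def derivCLM (k : ℕ) (z : 𝔻) : Bergman lam V →L[ℂ] V :=
  LinearMap.mkContinuousOfExistsBound
    { toFun f := discDeriv k f z
      map_add' f g := by
        rw [RKHS.coe_add, (isHol f).discDeriv_add (isHol g)]
        rfl
      map_smul' c f := by
        rw [RKHS.coe_smul, (isHol f).discDeriv_const_smul]
        rfl } (norm_discDeriv_le k z)

lemma derivCLM_apply (k : ℕ) (z : 𝔻) (f : Bergman lam V) :
    derivCLM lam V k z f = discDeriv k f z := rfl

/-- The vector that represents the `k`-th derivative at the centre is a multiple of `z ^ k`. -/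
lemma adjoint_derivCLM_zero (k : ℕ) (v : V) :
    ((derivCLM lam V k 0).adjoint v : 𝔻 → V) = fun z : 𝔻 ↦ (z : ℂ) ^ k •
      ((((ascPochhammer ℝ k).eval (2 * (lam : ℝ)) : ℝ) : ℂ) • v) := by
  funext z
  refine ext_inner_left ℂ fun u ↦ ?_
  rw [← RKHS.kerFun_inner, ContinuousLinearMap.adjoint_inner_right, derivCLM_apply,
    discDeriv_kerFun]
  simp only [UnitDisc.coe_zero, zero_mul, sub_zero, Complex.one_cpow, mul_one, inner_smul_left,
    inner_smul_right, map_mul, map_pow, Complex.conj_conj, Complex.conj_ofReal]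
  ring

lemma derivCLM_zero_adjoint (k : ℕ) (v : V) :
    derivCLM lam V k 0 ((derivCLM lam V k 0).adjoint v) =
      ((k.factorial * (ascPochhammer ℝ k).eval (2 * (lam : ℝ)) : ℝ) : ℂ) • v := by
  rw [derivCLM_apply, adjoint_derivCLM_zero, discDeriv_pow_smul, smul_smul]
  push_cast
  rfl

end Bergman

/-! ### Transformation of higher derivatives -/

/-- The coefficient `(k choose i) * (x + i)_(k - i)` for `x > 0`, written with the quotient
`(x)_k / (x)_i`. It vanishes for `i > k`. -/
def transCoeff (x : ℝ) (k i : ℕ) : ℝ :=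
  k.choose i * (ascPochhammer ℝ k).eval x / (ascPochhammer ℝ i).eval x

lemma transCoeff_self_succ (x : ℝ) (k : ℕ) : transCoeff x k (k + 1) = 0 := by
  simp [transCoeff]

lemma transCoeff_succ_zero (x : ℝ) (k : ℕ) :
    transCoeff x (k + 1) 0 = (x + k) * transCoeff x k 0 := by
  simp [transCoeff, ascPochhammer_succ_eval, mul_comm]

lemma transCoeff_succ_succ {x : ℝ} (hx : 0 < x) {k i : ℕ} (hi : i ≤ k) :
    transCoeff x (k + 1) (i + 1) =
      (x + k + (i + 1)) * transCoeff x k (i + 1) + transCoeff x k i := by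
  have hA := (ascPochhammer_pos i x hx).ne'
  have hxi : x + i ≠ 0 := by positivity
  have h := Nat.choose_succ_right_eq k i
  apply_fun ((↑) : ℕ → ℝ) at h
  push_cast [Nat.cast_sub hi] at h
  simp only [transCoeff, ascPochhammer_succ_eval, Nat.choose_succ_succ', Nat.cast_add]
  field_simp
  linear_combination -(ascPochhammer ℝ k).eval x * h

section Transformation

variable {W : Type*} [NormedAddCommGroup W] [NormedSpace ℂ W] [CompleteSpace W]

/-- The higher derivatives of `g'(z) ^ s • f (g z)`. Each differentiation either hits the power of
`g'`, whose derivative is `-2 * s * c * g'(z) ^ (s + 1 / 2)`, or moves `f` to its next derivative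
and produces a factor `g'`. -/
lemma IsHol.discDeriv_derivPow_smul {f : 𝔻 → W} (hf : IsHol f) (g : UCover) {s : ℝ} (hs : 0 < s)
    (k : ℕ) : MoebiusBundle.discDeriv k (fun z ↦ g.derivPow z s • f (g • z)) = fun z ↦
      ∑ i ∈ Finset.range (k + 1), ((transCoeff (2 * s) k i : ℂ) * (-g.mat.c) ^ (k - i) *
        g.derivPow z (s + (k + i) / 2)) • MoebiusBundle.discDeriv i f (g • z) := by
  induction k with
  | zero =>
    funext z
    simp [discDeriv_zero, transCoeff]
  | succ k ih =>
    refine discDeriv_succ fun z ↦ ?_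
    rw [ih]
    have hterm : ∀ i ∈ Finset.range (k + 1), HasDerivAt
        (fun w ↦ ((transCoeff (2 * s) k i : ℂ) * (-g.mat.c) ^ (k - i)) •
          (discExtend (fun w ↦ g.derivPow w (s + (k + i) / 2)) w •
            discExtend (fun w ↦ MoebiusBundle.discDeriv i f (g • w)) w)) _ (z : ℂ) := fun i _ ↦
      ((g.hasDerivAt_derivPow _ z).smul
        (g.hasDerivAt_comp_smul (hf.hasDerivAt_discDeriv i (g • z)))).const_smul
        ((transCoeff (2 * s) k i : ℂ) * (-g.mat.c) ^ (k - i))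
    refine hasDerivAt_discExtend (fun w ↦ ?_) ((HasDerivAt.fun_sum hterm).congr_deriv ?_)
    · simp only [discExtend_coe, smul_smul]
    -- The terms of the sum for `k + 1`, without their coefficients.
    set T : ℕ → W := fun i ↦ ((-g.mat.c) ^ (k + 1 - i) * g.derivPow z (s + (k + 1 + i) / 2)) •
      MoebiusBundle.discDeriv i f (g • z) with hT
    have hstep : ∀ i ∈ Finset.range (k + 1),
        ((transCoeff (2 * s) k i : ℂ) * (-g.mat.c) ^ (k - i)) •
          (discExtend (fun w ↦ g.derivPow w (s + (k + i) / 2)) z •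
              g.derivPow z 1 • MoebiusBundle.discDeriv (i + 1) f (g • z) +
            (-2 * ((s + (k + i) / 2 : ℝ) : ℂ) * g.mat.c *
              g.derivPow z (s + (k + i) / 2 + 1 / 2)) •
                discExtend (fun w ↦ MoebiusBundle.discDeriv i f (g • w)) z) =
        (((2 * s + k + i) * transCoeff (2 * s) k i : ℝ) : ℂ) • T i +
          (transCoeff (2 * s) k i : ℂ) • T (i + 1) := by
      intro i hi
      have hi : i ≤ k := Nat.lt_succ_iff.1 (Finset.mem_range.1 hi)
      rw [discExtend_coe, discExtend_coe, add_comm, hT]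
      simp only [smul_add, smul_smul]
      congr 2
      · rw [Nat.succ_sub hi, pow_succ,
          show s + (k + i) / 2 + 1 / 2 = s + (k + 1 + i) / 2 by ring]
        push_cast
        ring
      · rw [Nat.succ_sub_succ, mul_assoc, ← UCover.derivPow_add]
        congr 3
        push_cast
        ring
    rw [Finset.sum_congr rfl hstep, Finset.sum_add_distrib]
    -- The coefficient of index `k + 1` vanishes, so one more summand can be admitted.
    have h0 : ∑ i ∈ Finset.range (k + 1),
          (((2 * s + k + i) * transCoeff (2 * s) k i : ℝ) : ℂ) • T i =
        ∑ i ∈ Finset.range (k + 2), (((2 * s + k + i) * transCoeff (2 * s) k i : ℝ) : ℂ) • T i := by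
      rw [Finset.sum_range_succ _ (k + 1), transCoeff_self_succ]
      simp
    rw [h0, Finset.sum_range_succ' _ (k + 1), add_right_comm, ← Finset.sum_add_distrib,
      Finset.sum_range_succ' _ (k + 1)]
    congr 1
    · refine Finset.sum_congr rfl fun i hi ↦ ?_
      have hi : i ≤ k := Nat.lt_succ_iff.1 (Finset.mem_range.1 hi)
      rw [transCoeff_succ_succ (by positivity) hi, ← add_smul, hT, smul_smul]
      push_cast
      congr 1
      ring
    · rw [transCoeff_succ_zero, hT, smul_smul]
      push_cast
      congr 1
      ring_nf

end Transformation

lemma gammaCoeff_mul_transCoeff {η : ℝ} (hη : 0 < η) (j k i : ℕ) (hi : i ≤ k) :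
    gammaCoeff η j (j + k) * transCoeff (2 * (η + j)) k i =
      1 / (k - i).factorial * gammaCoeff η j (j + i) := by
  have h1 := (ascPochhammer_pos k (2 * (η + j)) (by positivity)).ne'
  have h2 := (ascPochhammer_pos i (2 * (η + j)) (by positivity)).ne'
  simp only [gammaCoeff, transCoeff, Nat.add_sub_cancel_left, ← mul_add, Nat.cast_choose ℝ hi]
  field_simp

lemma sum_range_eq_sum_fin_ite {M : Type*} [AddCommMonoid M] {m : ℕ} (j p : Fin (m + 1))
    (hjp : j ≤ p) (G : ℕ → M) :
    ∑ i ∈ Finset.range ((p : ℕ) - j + 1), G (j + i) =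
      ∑ l : Fin (m + 1), if l ≤ p then if j ≤ l then G l else 0 else 0 := by
  have h := Fin.sum_univ_eq_sum_range
    (fun n ↦ if n ≤ (p : ℕ) then if (j : ℕ) ≤ n then G n else 0 else 0) (m + 1)
  simp only [Fin.val_fin_le] at h
  rw [h, ← Nat.sub_add_comm (Fin.le_def.1 hjp), ← Finset.sum_Ico_eq_sum_range]
  refine (Finset.sum_congr rfl fun i hi ↦ ?_).trans (Finset.sum_subset (fun i hi ↦ ?_) ?_)
  · have := Finset.mem_Ico.1 hi
    rw [if_pos (by omega), if_pos (by omega)]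
  · have := Finset.mem_Ico.1 hi
    exact Finset.mem_range.2 (by omega)
  · intro i _ hi
    rw [Finset.mem_Ico] at hi
    split_ifs <;> first | rfl | omega

/-- The normalized derivatives `gammaCoeff η j p • f^(p - j)` of functions of weight `η + j`
transform with the scalar factors of the multiplier. -/
lemma IsHol.gammaCoeff_smul_discDeriv {W : Type*} [NormedAddCommGroup W] [NormedSpace ℂ W]
    [CompleteSpace W] {f : 𝔻 → W} (hf : IsHol f) (g : UCover) {η : ℝ} (hη : 0 < η) {m : ℕ}
    {j p : Fin (m + 1)} (hjp : j ≤ p) (z : 𝔻) :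
    (gammaCoeff η j p : ℂ) • MoebiusBundle.discDeriv ((p : ℕ) - j)
        (fun z ↦ g.derivPow z (η + (j : ℕ)) • f (g • z)) z =
      ∑ l : Fin (m + 1), if l ≤ p then if j ≤ l then
        ((1 / ((p : ℕ) - (l : ℕ)).factorial : ℂ) * (-g.mat.c) ^ ((p : ℕ) - (l : ℕ)) *
          g.derivPow z (η + ((p : ℕ) + (l : ℕ)) / 2)) • (gammaCoeff η j l : ℂ) •
            MoebiusBundle.discDeriv ((l : ℕ) - j) f (g • z) else 0 else 0 := by
  have h := sum_range_eq_sum_fin_ite j p hjp fun l : ℕ ↦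
    ((1 / ((p : ℕ) - l).factorial : ℂ) * (-g.mat.c) ^ ((p : ℕ) - l) *
      g.derivPow z (η + ((p : ℕ) + l) / 2)) • (gammaCoeff η j l : ℂ) •
        MoebiusBundle.discDeriv (l - j) f (g • z)
  rw [← h, hf.discDeriv_derivPow_smul g (by positivity), Finset.smul_sum]
  refine Finset.sum_congr rfl fun i hi ↦ ?_
  have hi : i ≤ (p : ℕ) - j := Nat.lt_succ_iff.1 (Finset.mem_range.1 hi)
  have hp : (j : ℕ) + ((p : ℕ) - j) = p := Nat.add_sub_cancel' hjp
  have hc := gammaCoeff_mul_transCoeff hη j _ i hi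
  rw [hp] at hc
  have hs : η + (j : ℕ) + ((((p : ℕ) - j : ℕ) : ℝ) + i) / 2 =
      η + ((p : ℕ) + (((j : ℕ) + i : ℕ) : ℝ)) / 2 := by
    rw [Nat.cast_sub (Fin.le_def.1 hjp)]
    push_cast
    ring
  rw [smul_smul, smul_smul, hs, ← mul_assoc, ← mul_assoc, ← Complex.ofReal_mul, hc,
    Nat.add_sub_cancel_left, Nat.sub_sub]
  congr 1
  push_cast
  ring

/-! ### Rectangular matrices as operators -/

section MatCLM

/-- The operator between Euclidean spaces given by a matrix. -/
def matCLM {a b : ℕ} (B : Matrix (Fin a) (Fin b) ℂ) :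
    EuclideanSpace ℂ (Fin b) →L[ℂ] EuclideanSpace ℂ (Fin a) :=
  LinearMap.toContinuousLinearMap (Matrix.toLpLin 2 2 B)

variable {a b c : ℕ}

lemma matCLM_apply (B : Matrix (Fin a) (Fin b) ℂ) (v : EuclideanSpace ℂ (Fin b)) :
    matCLM B v = WithLp.toLp 2 (B.mulVec v.ofLp) := rfl

lemma matCLM_mul_apply (B : Matrix (Fin a) (Fin b) ℂ) (C : Matrix (Fin b) (Fin c) ℂ)
    (v : EuclideanSpace ℂ (Fin c)) : matCLM (B * C) v = matCLM B (matCLM C v) := by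
  simp only [matCLM_apply, Matrix.mulVec_mulVec]

lemma matCLM_smul_apply (r : ℂ) (B : Matrix (Fin a) (Fin b) ℂ) (v : EuclideanSpace ℂ (Fin b)) :
    matCLM (r • B) v = r • matCLM B v := by
  simp only [matCLM_apply, Matrix.smul_mulVec, WithLp.toLp_smul]

lemma adjoint_matCLM (B : Matrix (Fin a) (Fin b) ℂ) :
    (matCLM B).adjoint = matCLM B.conjTranspose := by
  ext1 v
  exact (LinearMap.congr_fun (Matrix.toEuclideanLin_conjTranspose_eq_adjoint B) v).symm

lemma matCLM_single (B : Matrix (Fin a) (Fin b) ℂ) (i : Fin a) (j : Fin b) :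
    matCLM B (EuclideanSpace.single j 1) i = B i j := by
  simp [matCLM_apply]

end MatCLM

/-! ### The operator `Γ_N` on the direct sum of Bergman spaces -/

section Gamma

/-- The weight `η + j` of the component of index `j`. -/
abbrev shiftWeight {η : ℝ} (hη : 0 < η) (j : ℕ) : Set.Ioi (0 : ℝ) :=
  ⟨η + j, add_pos_of_pos_of_nonneg hη (Nat.cast_nonneg _)⟩

variable {m : ℕ} {d : Fin (m + 1) → ℕ}
  (Y : ∀ i : Fin m, Matrix (Fin (d i.succ)) (Fin (d i.castSucc)) ℂ)

lemma yProd_mul_yProd {j l p : Fin (m + 1)} (hjl : j ≤ l) (hlp : l ≤ p) :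
    yProd Y l p * yProd Y j l = yProd Y j p := by
  induction p using Fin.induction with
  | zero =>
    obtain rfl := Fin.le_zero_iff.1 hlp
    rw [yProd_self, Matrix.one_mul]
  | succ i ih =>
    rcases hlp.eq_or_lt with rfl | h
    · rw [yProd_self, Matrix.one_mul]
    · have h' := Fin.le_castSucc_iff.2 h
      rw [yProd_succ Y h', yProd_succ Y (hjl.trans h'), Matrix.mul_assoc, ih h']

lemma blockMulVec_apply (B : ∀ p l, Matrix (Fin (d p)) (Fin (d l)) ℂ) (v : Fib d)
    (p : Fin (m + 1)) : blockMulVec B v p = ∑ l, matCLM (B p l) (v l) := by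
  simp only [blockMulVec, matCLM_apply, WithLp.toLp_sum]

lemma gammaCoeff_self (η : ℝ) (j : ℕ) : gammaCoeff η j j = 1 := by
  simp [gammaCoeff]

variable {η : ℝ} {hη : 0 < η} (N : ∀ j : Fin (m + 1), Matrix (Fin (d j)) (Fin (d j)) ℂ)

variable (η) in
lemma gammaN_apply (F : 𝔻 → Fib d) (hF : ∀ j, IsHol fun z ↦ F z j) (z : 𝔻) (l : Fin (m + 1)) :
    gammaN Y η N F z l = ∑ j, if j ≤ l then
      (gammaCoeff η j l : ℂ) • matCLM (yProd Y j l * N j)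
        (discDeriv ((l : ℕ) - j) (fun w ↦ F w j) z) else 0 := by
  simp only [gammaN, gammaOp, WithLp.toLp_sum]
  refine Finset.sum_congr rfl fun j _ ↦ ?_
  split_ifs
  · rw [matCLM_mul_apply, matCLM_apply (yProd Y j l), WithLp.toLp_smul]
    have h := congrFun ((hF j).discDeriv_clm_comp (matCLM (N j)) ((l : ℕ) - j)) z
    rw [← h]
    rfl
  · rfl

lemma gammaN_toFunction_apply (f : BergmanSum d η hη) (z : 𝔻) (l : Fin (m + 1)) :
    gammaN Y η N f.toFunction z l = ∑ j, if j ≤ l then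
      (gammaCoeff η j l : ℂ) • matCLM (yProd Y j l * N j)
        (discDeriv ((l : ℕ) - j) (f j) z) else 0 :=
  gammaN_apply Y η N f.toFunction (fun j ↦ Bergman.isHol (f j)) z l

variable (hη) in
/-- The evaluation at `z` of the component of index `l` of `Γ_N`. -/
def gammaEvalComp (z : 𝔻) (l : Fin (m + 1)) :
    BergmanSum d η hη →L[ℂ] EuclideanSpace ℂ (Fin (d l)) :=
  ∑ j, if j ≤ l then
    (gammaCoeff η j l : ℂ) • matCLM (yProd Y j l * N j) ∘L
      Bergman.derivCLM (shiftWeight hη j) _ ((l : ℕ) - j) z ∘L PiLp.proj 2 _ j else 0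

lemma gammaEvalComp_apply (z : 𝔻) (l : Fin (m + 1)) (f : BergmanSum d η hη) :
    gammaEvalComp Y hη N z l f = ∑ j, if j ≤ l then
      (gammaCoeff η j l : ℂ) • matCLM (yProd Y j l * N j)
        (discDeriv ((l : ℕ) - j) (f j) z) else 0 := by
  rw [gammaEvalComp, sum_apply]
  refine Finset.sum_congr rfl fun j _ ↦ ?_
  split_ifs <;> rfl

variable (hη) in
/-- The evaluation at `z` of `Γ_N`. -/
def gammaEval (z : 𝔻) : BergmanSum d η hη →L[ℂ] Fib d :=
  (PiLp.continuousLinearEquiv 2 ℂ _).symm.toContinuousLinearMap ∘L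
    ContinuousLinearMap.pi fun l ↦ gammaEvalComp Y hη N z l

lemma gammaEval_apply_apply (z : 𝔻) (f : BergmanSum d η hη) (l : Fin (m + 1)) :
    gammaEval Y hη N z f l = gammaEvalComp Y hη N z l f := rfl

lemma gammaEval_eq_gammaN (z : 𝔻) (f : BergmanSum d η hη) :
    gammaEval Y hη N z f = gammaN Y η N f.toFunction z := by
  ext1 l
  rw [gammaN_toFunction_apply, gammaEval_apply_apply, gammaEvalComp_apply]

/-- `Γ_N` is injective, as a block triangular operator whose diagonal blocks `N j` are
invertible. -/
lemma eq_zero_of_gammaEval_eq_zero (hN : ∀ j, IsUnit (N j)) {f : BergmanSum d η hη}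
    (hf : ∀ z, gammaEval Y hη N z f = 0) : f = 0 := by
  ext1 l
  induction l using WellFoundedLT.induction with
  | ind l ih =>
  refine RKHS.ext fun z ↦ ?_
  have h : gammaEvalComp Y hη N z l f = 0 := by
    rw [← gammaEval_apply_apply, hf]
    rfl
  rw [gammaEvalComp_apply, Finset.sum_eq_single l] at h
  · rw [if_pos le_rfl, Nat.sub_self, discDeriv_zero, gammaCoeff_self, yProd_self, Matrix.one_mul,
      Complex.ofReal_one, one_smul] at h
    obtain ⟨M, hM⟩ := (hN l).exists_left_inv
    have h1 := congrArg (matCLM M) h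
    rw [← matCLM_mul_apply, hM, map_zero] at h1
    simpa [matCLM_apply] using h1
  · intro j _ hj
    split_ifs with hjl
    · rw [ih j (lt_of_le_of_ne hjl hj)]
      have h0 : Bergman.derivCLM (shiftWeight hη j) (EuclideanSpace ℂ (Fin (d j))) ((l : ℕ) - j) z 0
        = 0 := map_zero _
      rw [Bergman.derivCLM_apply] at h0
      rw [PiLp.zero_apply, h0, map_zero, smul_zero]
    · rfl
  · simp

lemma isHol_gammaN (f : BergmanSum d η hη) : IsHol (gammaN Y η N f.toFunction) := by
  have h : ∀ l, IsHol fun z ↦ gammaN Y η N f.toFunction z l := by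
    intro l
    simp only [gammaN_toFunction_apply]
    refine IsHol.sum fun j _ ↦ ?_
    split_ifs
    · exact ((Bergman.isHol (f j)).discDeriv ((l : ℕ) - j)).clm_comp
        ((gammaCoeff η j l : ℂ) • matCLM (yProd Y j l * N j))
    · exact isHol_of_differentiableOn (G := 0) (fun _ ↦ rfl) (differentiableOn_const 0)
  refine isHol_of_differentiableOn (G := fun w ↦ WithLp.toLp 2 fun l ↦
    discExtend (fun z ↦ gammaN Y η N f.toFunction z l) w) (fun z ↦ ?_) ?_
  · ext1 l
    exact discExtend_coe (fun z ↦ gammaN Y η N f.toFunction z l) z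
  · exact ((PiLp.continuousLinearEquiv 2 ℂ
      fun j ↦ EuclideanSpace ℂ (Fin (d j))).symm.differentiable).comp_differentiableOn
        (differentiableOn_pi.2 h)

/-- The unitary action of the covering group on the direct sum of the spaces
`𝔸^(η+j) ⊗ ℂ^(d j)`. -/
def bergmanSumAction (d : Fin (m + 1) → ℕ) (hη : 0 < η) :
    UCover →* (BergmanSum d η hη ≃ₗᵢ[ℂ] BergmanSum d η hη) :=
  MonoidHom.mk' (fun g ↦ LinearIsometryEquiv.piLpCongrRight 2 fun j ↦ Bergman.action _ _ g)
    fun g h ↦ by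
      ext1 f
      simp only [map_mul]
      rfl

lemma bergmanSumAction_apply (g : UCover) (f : BergmanSum d η hη) (j : Fin (m + 1)) (z : 𝔻) :
    bergmanSumAction d hη g f j z = g⁻¹.derivPow z (η + (j : ℕ)) • f j (g⁻¹ • z) :=
  Bergman.action_apply _ _ g (f j) z

/-- The equivariance of `Γ_N`. -/
lemma gammaN_bergmanSumAction (g : UCover) (f : BergmanSum d η hη) (z : 𝔻) :
    gammaN Y η N (bergmanSumAction d hη g f).toFunction z =
      blockMulVec (multiplier Y η g⁻¹ z) (gammaN Y η N f.toFunction (g⁻¹ • z)) := by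
  ext1 p
  rw [gammaN_toFunction_apply, blockMulVec_apply]
  simp only [gammaN_toFunction_apply, map_sum]
  rw [Finset.sum_comm]
  refine Finset.sum_congr rfl fun j _ ↦ ?_
  split_ifs with hjp
  · have h : (bergmanSumAction d hη g f j : 𝔻 → EuclideanSpace ℂ (Fin (d j))) =
        fun z ↦ g⁻¹.derivPow z (η + (j : ℕ)) • f j (g⁻¹ • z) :=
      funext (bergmanSumAction_apply g f j)
    rw [h, ← map_smul, (Bergman.isHol (f j)).gammaCoeff_smul_discDeriv g⁻¹ hη hjp, map_sum]
    refine Finset.sum_congr rfl fun l _ ↦ ?_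
    by_cases hlp : l ≤ p
    · by_cases hjl : j ≤ l
      · rw [if_pos hlp, if_pos hjl, if_pos hjl, multiplier, if_pos hlp, matCLM_smul_apply,
          map_smul (matCLM (yProd Y l p)), ← matCLM_mul_apply, ← Matrix.mul_assoc,
          yProd_mul_yProd Y hjl hlp, map_smul, map_smul]
      · rw [if_pos hlp, if_neg hjl, if_neg hjl, map_zero, map_zero]
    · rw [if_neg hlp, multiplier, if_neg hlp, map_zero]
      simp [matCLM]
  · refine (Finset.sum_eq_zero fun l _ ↦ ?_).symm
    split_ifs with hjl
    · rw [multiplier, if_neg fun hlp ↦ hjp (hjl.trans hlp)]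
      simp [matCLM]
    · exact map_zero _

end Gamma

/-! ### The image of `Γ_N` and its reproducing kernel at the centre -/

section Image

variable {m : ℕ} {d : Fin (m + 1) → ℕ} {η : ℝ}

/-- The image of `Γ_N`, encoded as a Hilbert space together with an injection into the functions on
the disc: the Hilbert space is the domain of `Γ_N`, which fixes the norm for which `Γ_N` is an
isometry, and the injection is `Γ_N` itself. -/
def GammaSpace (hη : 0 < η) (_Y : ∀ i : Fin m, Matrix (Fin (d i.succ)) (Fin (d i.castSucc)) ℂ)
    (N : ∀ j : Fin (m + 1), Matrix (Fin (d j)) (Fin (d j)) ℂ) (_hN : ∀ j, IsUnit (N j)) : Type :=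
  BergmanSum d η hη

namespace GammaSpace

variable (hη : 0 < η) (Y : ∀ i : Fin m, Matrix (Fin (d i.succ)) (Fin (d i.castSucc)) ℂ)
  (N : ∀ j : Fin (m + 1), Matrix (Fin (d j)) (Fin (d j)) ℂ) (hN : ∀ j, IsUnit (N j))

instance : NormedAddCommGroup (GammaSpace hη Y N hN) :=
  inferInstanceAs (NormedAddCommGroup (BergmanSum d η hη))

instance : InnerProductSpace ℂ (GammaSpace hη Y N hN) :=
  inferInstanceAs (InnerProductSpace ℂ (BergmanSum d η hη))

instance : CompleteSpace (GammaSpace hη Y N hN) :=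
  inferInstanceAs (CompleteSpace (BergmanSum d η hη))

/-- `Γ_N` as an isometry onto its image. -/
def equiv : BergmanSum d η hη ≃ₗᵢ[ℂ] GammaSpace hη Y N hN :=
  LinearIsometryEquiv.refl ℂ (BergmanSum d η hη)

/-- The continuity of the point evaluations makes the image of `Γ_N` a reproducing kernel Hilbert
space. -/
instance : RKHS ℂ (GammaSpace hη Y N hN) 𝔻 (Fib d) where
  coeCLM := ContinuousLinearMap.pi fun z ↦ gammaEval Y hη N z ∘L
    ((equiv hη Y N hN).symm.toContinuousLinearEquiv : GammaSpace hη Y N hN →L[ℂ] _)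
  coeCLM_injective := (injective_iff_map_eq_zero _).2 fun F hF ↦
    (equiv hη Y N hN).symm.map_eq_zero_iff.1 <|
      eq_zero_of_gammaEval_eq_zero Y N hN (f := (equiv hη Y N hN).symm F) fun z ↦ congrFun hF z

lemma equiv_apply_apply (f : BergmanSum d η hη) (z : 𝔻) :
    equiv hη Y N hN f z = gammaEval Y hη N z f := rfl

lemma coe_equiv (f : BergmanSum d η hη) :
    (equiv hη Y N hN f : 𝔻 → Fib d) = gammaN Y η N f.toFunction :=
  funext fun z ↦ gammaEval_eq_gammaN Y N z f

/-- The action of the covering group on the image of `Γ_N` that makes `Γ_N` equivariant. -/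
def action : UCover →* (GammaSpace hη Y N hN ≃ₗᵢ[ℂ] GammaSpace hη Y N hN) :=
  MonoidHom.mk' (fun g ↦ (equiv hη Y N hN).symm.trans
    ((bergmanSumAction d hη g).trans (equiv hη Y N hN))) fun g h ↦ by
      ext1 F
      rw [map_mul]
      rfl

lemma equiv_bergmanSumAction (g : UCover) (f : BergmanSum d η hη) :
    equiv hη Y N hN (bergmanSumAction d hη g f) = action hη Y N hN g (equiv hη Y N hN f) := rfl

lemma action_apply (g : UCover) (F : GammaSpace hη Y N hN) (z : 𝔻) :
    action hη Y N hN g F z = blockMulVec (multiplier Y η g⁻¹ z) (F (g⁻¹ • z)) := by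
  obtain ⟨f, rfl⟩ := (equiv hη Y N hN).surjective F
  rw [← equiv_bergmanSumAction, coe_equiv, coe_equiv, gammaN_bergmanSumAction]

lemma kernel_eq (z w : 𝔻) : RKHS.kernel (GammaSpace hη Y N hN) z w =
    gammaEval Y hη N z ∘L (gammaEval Y hη N w).adjoint := by
  ext1 v
  refine ext_inner_left ℂ fun u ↦ ?_
  rw [← RKHS.kerFun_apply, ← RKHS.kerFun_inner, ← (equiv hη Y N hN).symm.inner_map_map]
  have h : ∀ (x : 𝔻) (v : Fib d), (equiv hη Y N hN).symm (RKHS.kerFun _ x v) =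
      (gammaEval Y hη N x).adjoint v := by
    intro x v
    refine ext_inner_right ℂ fun f ↦ ?_
    rw [← (equiv hη Y N hN).inner_map_map, LinearIsometryEquiv.apply_symm_apply,
      RKHS.kerFun_inner, ContinuousLinearMap.adjoint_inner_left, equiv_apply_apply]
  rw [h, h, ContinuousLinearMap.adjoint_inner_left]
  rfl

end GammaSpace

variable (hη : 0 < η) (Y : ∀ i : Fin m, Matrix (Fin (d i.succ)) (Fin (d i.castSucc)) ℂ)
  (N : ∀ j : Fin (m + 1), Matrix (Fin (d j)) (Fin (d j)) ℂ)

/-- The component of index `j` of the adjoint of `gammaEvalComp Y hη N z l`. -/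
def gammaEvalCompAdjoint (z : 𝔻) (l : Fin (m + 1)) (u : EuclideanSpace ℂ (Fin (d l)))
    (j : Fin (m + 1)) : Bergman (shiftWeight hη j) (EuclideanSpace ℂ (Fin (d j))) :=
  if j ≤ l then (gammaCoeff η j l : ℂ) •
    (Bergman.derivCLM (shiftWeight hη j) _ ((l : ℕ) - j) z).adjoint
      (matCLM (yProd Y j l * N j).conjTranspose u) else 0

lemma adjoint_gammaEvalComp (z : 𝔻) (l : Fin (m + 1)) (u : EuclideanSpace ℂ (Fin (d l))) :
    (gammaEvalComp Y hη N z l).adjoint u = WithLp.toLp 2 (gammaEvalCompAdjoint hη Y N z l u) := by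
  refine ext_inner_right ℂ fun f ↦ ?_
  rw [ContinuousLinearMap.adjoint_inner_left, gammaEvalComp_apply, inner_sum,
    PiLp.inner_apply (f := fun j : Fin (m + 1) ↦
      Bergman (shiftWeight hη j) (EuclideanSpace ℂ (Fin (d j))))]
  refine Finset.sum_congr rfl fun j _ ↦ ?_
  change _ = inner ℂ (gammaEvalCompAdjoint hη Y N z l u j) (f j)
  rw [gammaEvalCompAdjoint]
  split_ifs
  · rw [inner_smul_left, inner_smul_right, ContinuousLinearMap.adjoint_inner_left,
      ← adjoint_matCLM, ContinuousLinearMap.adjoint_inner_left, Complex.conj_ofReal]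
    rfl
  · rw [inner_zero_left, inner_zero_right]

lemma adjoint_gammaEval_single (z : 𝔻) (l : Fin (m + 1)) (u : EuclideanSpace ℂ (Fin (d l))) :
    (gammaEval Y hη N z).adjoint (PiLp.single 2 l u) = (gammaEvalComp Y hη N z l).adjoint u := by
  refine ext_inner_right ℂ fun f ↦ ?_
  rw [ContinuousLinearMap.adjoint_inner_left, ContinuousLinearMap.adjoint_inner_left,
    ← gammaEval_apply_apply, PiLp.inner_apply, Finset.sum_eq_single l]
  · rw [PiLp.single_eq_same]
  · intro j _ hj
    rw [PiLp.single_eq_of_ne _ hj, inner_zero_left]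
  · simp

/-- The diagonal blocks of `Γ_N` at the centre, composed with their adjoints. The squared norm
`k! * (2η+2j)_k` of the `k`-th derivative at the centre cancels one of the two coefficients. -/
lemma gammaEvalComp_zero_adjoint (l : Fin (m + 1)) (u : EuclideanSpace ℂ (Fin (d l))) :
    gammaEvalComp Y hη N 0 l ((gammaEvalComp Y hη N 0 l).adjoint u) =
      ∑ j ∈ Finset.Iic l, (gammaCoeff η j l : ℂ) •
        matCLM ((yProd Y j l * N j) * (yProd Y j l * N j).conjTranspose) u := by
  rw [adjoint_gammaEvalComp, gammaEvalComp_apply, ← Finset.filter_ge_eq_Iic, Finset.sum_filter]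
  refine Finset.sum_congr rfl fun j _ ↦ ?_
  split_ifs with hjl
  · have h : discDeriv ((l : ℕ) - j) (gammaEvalCompAdjoint hη Y N 0 l u j) 0 =
        matCLM (yProd Y j l * N j).conjTranspose u := by
      rw [gammaEvalCompAdjoint, if_pos hjl, ← Bergman.derivCLM_apply, map_smul,
        Bergman.derivCLM_zero_adjoint, smul_smul, ← Complex.ofReal_mul]
      have h1 := (ascPochhammer_pos ((l : ℕ) - j) (2 * (η + (j : ℕ))) (by positivity)).ne'
      have h2 : gammaCoeff η j l * (((l : ℕ) - j).factorial *
          (ascPochhammer ℝ ((l : ℕ) - j)).eval (2 * (η + (j : ℕ)))) = 1 := by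
        rw [gammaCoeff, ← mul_add]
        field_simp
      rw [h2, Complex.ofReal_one, one_smul]
    rw [matCLM_mul_apply _ (Matrix.conjTranspose _), ← h]
  · rfl

lemma GammaSpace.diagBlock_kernel_zero (hN : ∀ j, IsUnit (N j)) (l : Fin (m + 1)) :
    diagBlock (RKHS.kernel (GammaSpace hη Y N hN) 0 0) l =
      ∑ j ∈ Finset.Iic l, (gammaCoeff η j l : ℂ) •
        (yProd Y j l * N j * (N j).conjTranspose * (yProd Y j l).conjTranspose) := by
  ext a b
  rw [diagBlock, Matrix.of_apply, GammaSpace.kernel_eq, ContinuousLinearMap.comp_apply,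
    adjoint_gammaEval_single, gammaEval_apply_apply, gammaEvalComp_zero_adjoint, Matrix.sum_apply,
    WithLp.ofLp_sum, Finset.sum_apply]
  refine Finset.sum_congr rfl fun j _ ↦ ?_
  rw [PiLp.smul_apply, matCLM_single, Matrix.conjTranspose_mul, Matrix.smul_apply]
  simp only [Matrix.mul_assoc]

end Image

end MoebiusBundle

end

theorem mainTheorem4 {m : ℕ} (d : Fin (m + 1) → ℕ) (η : ℝ) (hη : 0 < η)
    (Y : ∀ i : Fin m, Matrix (Fin (d i.succ)) (Fin (d i.castSucc)) ℂ)
    (N : ∀ j : Fin (m + 1), Matrix (Fin (d j)) (Fin (d j)) ℂ)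
    (hN : ∀ j, IsUnit (N j)) :
    ∃ (H : Type) (_ : NormedAddCommGroup H) (_ : InnerProductSpace ℂ H) (_ : CompleteSpace H)
      (_ : RKHS ℂ H 𝔻 (Fib d))
      (Φ : BergmanSum d η hη ≃ₗᵢ[ℂ] H)
      (D : UCover →* (BergmanSum d η hη ≃ₗᵢ[ℂ] BergmanSum d η hη))
      (U : UCover →* (H ≃ₗᵢ[ℂ] H)),
      (∀ f : BergmanSum d η hη, (Φ f : 𝔻 → Fib d) = gammaN Y η N f.toFunction) ∧
      (∀ F : H, IsHol (F : 𝔻 → Fib d)) ∧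
      (∀ (g : UCover) (f : BergmanSum d η hη) (j : Fin (m + 1)) (z : 𝔻),
        D g f j z = g⁻¹.derivPow z (η + (j : ℕ)) • f j (g⁻¹ • z)) ∧
      (∀ (g : UCover) (F : H) (z : 𝔻),
        U g F z = blockMulVec (multiplier Y η g⁻¹ z) (F (g⁻¹ • z))) ∧
      (∀ (g : UCover) (f : BergmanSum d η hη), Φ (D g f) = U g (Φ f)) ∧
      ∀ l : Fin (m + 1), diagBlock (RKHS.kernel H 0 0) l =
        ∑ j ∈ Finset.Iic l, (gammaCoeff η j l : ℂ) •
          (yProd Y j l * N j * (N j).conjTranspose * (yProd Y j l).conjTranspose) := by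
  refine ⟨GammaSpace hη Y N hN, inferInstance, inferInstance, inferInstance, inferInstance,
    GammaSpace.equiv hη Y N hN, bergmanSumAction d hη, GammaSpace.action hη Y N hN,
    GammaSpace.coe_equiv hη Y N hN, fun F ↦ ?_, bergmanSumAction_apply,
    GammaSpace.action_apply hη Y N hN, GammaSpace.equiv_bergmanSumAction hη Y N hN,
    GammaSpace.diagBlock_kernel_zero hη Y N hN⟩
  obtain ⟨f, rfl⟩ := (GammaSpace.equiv hη Y N hN).surjective F
  rw [GammaSpace.coe_equiv]
  exact isHol_gammaN Y N f
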